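/- Let $H$ and $E$ be real Hilbert spaces, let $M$ be a paracompact Hausdorff manifold of class $C^2$ modelled on $H$, and let $\mathcal E$ be a (continuous) essential subbundle of $TM$, i.e. a choice for every $p\in M$ of a class $\mathcal E(p)$ of closed linear subspaces of $T_pM$ modulo compact perturbation ($V\sim W$ iff the difference $P_V-P_W$ of the orthogonal projections is compact) which is locally represented by a continuous subbundle of $TM$. Let $\{M_i,N_i,\mathcal Q_i\}_{i\in I}$ be an admissible presentation of $\mathcal E$. This means that $\{M_i\}_{i\in I}$ is an open covering of $M$; each $N_i$ is a $C^2$ manifold modelled on $E$ with a $C^1$ Riemannian metric whose distance is complete; the maps $\mathcal Q_i:M_i\to N_i$ are $C^1$ and all the differentials $D\mathcal Q_i(p)$, $i\in I$, $p\in M_i$, are semi-Fredholm with one and the same index in $\{0,1,2,\dots\}\cup\{+\infty\}$; and * for every $i\in I$ and $p\in M_i$, $\ker D\mathcal Q_i(p)$ belongs to the class $\mathcal E(p)$; * for all $i,j\in I$ and $A\subset M_i\cap M_j$, $\mathcal Q_i(A)$ is pre-compact (has compact closure in $N_i$) if and only if $\mathcal Q_j(A)$ is pre-compact; * every $M_i$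 has non-empty intersection with only finitely many $M_j$; * there is $r>0$ such that for every $p\in M$ there is $i\in I$ with $p\in M_i$ and $\overline{\mathcal Q_i^{-1}(B_r(\mathcal Q_i(p)))}\subset M_i$ (closure in $M$). For a subset $A$ of a space $X$ with an extended distance, let $\beta_X(A)\in[0,+\infty]$ be the infimum of all $r>0$ such that $A$ is covered by finitely many balls of radius $r$ of $X$. Let $F$ be a $C^1$ tangent vector field on $M$ which is complete, i.e. its flow $\phi(t,p)$ is defined for all $(t,p)\in\mathbb R\times M$, and assume that $F$ satisfies (C3)(i) there is $b>0$ such that $\|D\mathcal Q_i(p)[F(p)]\|\le b$ for every $i\in I$ and $p\in M_i$; (C3)(ii) for every $i\in I$ and $q\in N_i$ there are $\delta>0$ and $c\ge 0$ such that $$\beta_{TN_i}\bigl(D\mathcal Q_i(F(A))\bigr)\le c\,\beta_{N_i}(\mathcal Q_i(A))\qquad\text{for all } A\subset \mathcal Q_i^{-1}(B_\delta(q)),$$ where $D\mathcal Q_i(F(A))\subset TN_i$ and $TN_i$ carries the distance of the Sasaki metric, the standard metric induced by the Riemannian structure of $N_i$. Let $\mathcal F$ be the family of all $A\subset M$ which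 are covered by finitely many of the $M_i$ and such that $\mathcal Q_i(A\cap M_i)$ is pre-compact for every $i\in I$. Then $\mathcal F$ is positively invariant for the flow of $F$: for every $A\in\mathcal F$ and every $t\ge 0$, the set $\phi([0,t]\times A)$ belongs to $\mathcal F$. -/

import Mathlib

open Set Filter Topology MeasureTheory Bundle Manifold
open scoped ENNReal NNReal ContDiff

noncomputable section

namespace EssentialFlow

/-! ### Hausdorff measure of non-compactness -/

/-- The Hausdorff measure of non-compactness of `A ⊆ X`, where `X` carries the extended distance
`d`: the infimum of the radii `r > 0` such that `A` is covered by finitely many `d`-balls of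
radius `r` (with centres anywhere in `X`). -/
def hausdorffMNC {X : Type*} (d : X → X → ℝ≥0∞) (A : Set X) : ℝ≥0∞ :=
  sInf {r : ℝ≥0∞ | 0 < r ∧ ∃ C : Set X, C.Finite ∧ A ⊆ ⋃ x ∈ C, {y | d y x < r}}

/-! ### The Sasaki distance on the tangent bundle of a Riemannian manifold -/

section Sasaki

variable {E : Type*} [NormedAddCommGroup E] [InnerProductSpace ℝ E]
  {N : Type*} [TopologicalSpace N] [ChartedSpace E N] [IsManifold 𝓘(ℝ, E) 2 N]
  [RiemannianBundle (fun x : N ↦ TangentSpace 𝓘(ℝ, E) x)]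

/-- The Riemannian metric read in the preferred chart at `x`: the inner product, at the point of
`N` with coordinate `y`, of the tangent vectors with coordinates `u` and `w`. -/
def metricInChart (x : N) (y u w : E) : ℝ :=
  let e := trivializationAt E (fun z : N ↦ TangentSpace 𝓘(ℝ, E) z) x
  let q : N := (extChartAt 𝓘(ℝ, E) x).symm y
  inner ℝ (e.symm q u) (e.symm q w)

/-- The derivative at the point `x` of the coefficient `g(u, w)` of the metric (in the preferred
chart at `x`) in the direction `z`. -/
def metricDeriv (x : N) (z u w : E) : ℝ :=
  fderiv ℝ (fun y : E ↦ metricInChart x y u w) (extChartAt 𝓘(ℝ, E) x x) z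

/-- The Christoffel symbol of the first kind `g(Γ(z, v), w)` of the Levi-Civita connection, at the
point `x` and in the preferred chart at `x`. -/
def christoffelFirst (x : N) (z v w : E) : ℝ :=
  (metricDeriv x z v w + metricDeriv x v z w - metricDeriv x w z v) / 2

/-- The velocity at time `t` of the base curve of a curve `c` in the tangent bundle. -/
def baseVelocity (c : ℝ → TangentBundle 𝓘(ℝ, E) N) (t : ℝ) :
    TangentSpace 𝓘(ℝ, E) (c t).proj :=
  mfderiv 𝓘(ℝ, ℝ) 𝓘(ℝ, E) (fun s ↦ (c s).proj) t (1 : ℝ)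

/-- The coordinates at time `s` of the vector component of `c`, in the preferred chart at the base
point of `c t`. -/
def fiberCoord (c : ℝ → TangentBundle 𝓘(ℝ, E) N) (t s : ℝ) : E :=
  (trivializationAt E (fun z : N ↦ TangentSpace 𝓘(ℝ, E) z) (c t).proj (c s)).2

/-- The derivative at time `t` of the coordinates `v` of the vector component of `c` in the
preferred chart at the base point of `c t`, seen as a tangent vector there. -/
def fiberVelocity (c : ℝ → TangentBundle 𝓘(ℝ, E) N) (t : ℝ) :
    TangentSpace 𝓘(ℝ, E) (c t).proj :=
  (deriv (fun s : ℝ ↦ fiberCoord c t s) t : E)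

/-- `D` is the Levi-Civita covariant derivative on `(0, 1)` of the vector field `c` along its base
curve: at each time, in the preferred chart at the base point, `D = v' + Γ(γ', v)`, where `γ` is
the base curve and `v` the vector component; the identity is tested against all vectors `w`. -/
def IsCovariantDerivative (c : ℝ → TangentBundle 𝓘(ℝ, E) N)
    (D : ∀ t : ℝ, TangentSpace 𝓘(ℝ, E) (c t).proj) : Prop :=
  ∀ t ∈ Ioo (0 : ℝ) 1, ∀ w : TangentSpace 𝓘(ℝ, E) (c t).proj,
    inner ℝ (D t) w = inner ℝ (fiberVelocity c t) w
      + christoffelFirst (E := E) (c t).proj (baseVelocity c t) (fiberCoord c t t) w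

/-- The distance on `TN` of the standard (Sasaki) metric: the infimum of
`∫₀¹ (|γ'|² + |D_t v|²)^{1/2} dt` over the `C¹` curves `c = (γ, v)` in `TN` joining the two given
tangent vectors. -/
def sasakiEDist (ξ η : TangentBundle 𝓘(ℝ, E) N) : ℝ≥0∞ :=
  ⨅ (c : ℝ → TangentBundle 𝓘(ℝ, E) N)
    (D : ∀ t : ℝ, TangentSpace 𝓘(ℝ, E) (c t).proj)
    (_ : ContMDiffOn 𝓘(ℝ, ℝ) 𝓘(ℝ, E).tangent 1 c (Icc 0 1) ∧ c 0 = ξ ∧ c 1 = η ∧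
      IsCovariantDerivative c D),
    ∫⁻ t in Ioo (0 : ℝ) 1, ENNReal.ofReal (√(‖baseVelocity c t‖ ^ 2 + ‖D t‖ ^ 2))

end Sasaki

/-! ### Semi-Fredholm operators -/

section SemiFredholm

variable {X Y : Type*} [AddCommGroup X] [Module ℝ X] [TopologicalSpace X]
  [AddCommGroup Y] [Module ℝ Y] [TopologicalSpace Y]

/-- A bounded operator is semi-Fredholm if it has closed range and its kernel or its cokernel is
finite dimensional. -/
def IsSemiFredholm (T : X →L[ℝ] Y) : Prop :=
  IsClosed (range T) ∧
    (FiniteDimensional ℝ (LinearMap.ker (T : X →ₗ[ℝ] Y)) ∨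
      FiniteDimensional ℝ (Y ⧸ LinearMap.range (T : X →ₗ[ℝ] Y)))

/-- The index `dim ker T - dim coker T ∈ ℤ ∪ {±∞}` of a semi-Fredholm operator. -/
def semiFredholmIndex (T : X →L[ℝ] Y) : EReal :=
  (((Module.rank ℝ (LinearMap.ker (T : X →ₗ[ℝ] Y))).toENat : ℝ≥0∞) : EReal) -
    (((Module.rank ℝ (Y ⧸ LinearMap.range (T : X →ₗ[ℝ] Y))).toENat : ℝ≥0∞) : EReal)

end SemiFredholm

/-! ### The essential Grassmannian and essential subbundles of the tangent bundle -/

section Essential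

variable (H : Type*) [NormedAddCommGroup H] [InnerProductSpace ℝ H] [CompleteSpace H]

/-- Two closed subspaces are equivalent when each is a compact perturbation of the other, i.e. the
difference of their orthogonal projections is a compact operator. -/
def compactPerturbation : Setoid (ClosedSubmodule ℝ H) where
  r V W := IsCompactOperator
    (V.toSubmodule.starProjection - W.toSubmodule.starProjection : H →L[ℝ] H)
  iseqv :=
    { refl := fun V ↦ by
        rw [sub_self]
        exact isCompactOperator_zero
      symm := fun {V W} h ↦ by
        rw [← neg_sub]
        exact h.neg
      trans := fun {U V W} h₁ h₂ ↦ by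
        rw [← sub_add_sub_cancel _ V.toSubmodule.starProjection _]
        exact h₁.add h₂ }

/-- The essential Grassmannian of `H`: closed subspaces modulo compact perturbation. -/
def EssentialGrassmannian : Type _ := Quotient (compactPerturbation H)

variable {H}

/-- The essential class of a closed subspace. -/
def essClass (V : ClosedSubmodule ℝ H) : EssentialGrassmannian H :=
  Quotient.mk (compactPerturbation H) V

variable (H) (M : Type*) [TopologicalSpace M] [ChartedSpace H M] [IsManifold 𝓘(ℝ, H) 2 M]

/-- The isomorphism from `T_x M` onto `H` given by the preferred chart at `p` (for `x` in the
domain of that chart); `T_x M` is itself identified with `H` by the preferred chart at `x`. -/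
def tangentCoord (p x : M) : H →L[ℝ] H :=
  (trivializationAt H (fun z : M ↦ TangentSpace 𝓘(ℝ, H) z) p).continuousLinearMapAt ℝ x

/-- A (continuous) essential subbundle of `TM`: a choice, for each `p`, of an essential class of
closed subspaces of `T_p M` (identified with `H` by the preferred chart at `p`; the class does not
depend on which chart is used, up to the corresponding linear isomorphism), which near every point
is represented by a continuous subbundle, i.e. in a chart by a family of closed subspaces `V x`
that is continuous for the operator norm distance of orthogonal projections. -/
structure EssentialSubbundle where
  /-- The essential class of subspaces of the tangent space at each point. -/
  fiber : M → EssentialGrassmannian H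
  exists_local_representative : ∀ p : M, ∃ U ∈ 𝓝 p, U ⊆ (chartAt H p).source ∧
    ∃ V : M → ClosedSubmodule ℝ H,
      ContinuousOn (fun x ↦ ((V x).toSubmodule.starProjection : H →L[ℝ] H)) U ∧
      ∀ x ∈ U, fiber x = essClass ((V x).comap (tangentCoord H M p x))

end Essential

/-! ### Presentations -/

section Presentation

variable {H : Type*} [NormedAddCommGroup H] [InnerProductSpace ℝ H] [CompleteSpace H]
  {M : Type*} [TopologicalSpace M] [ChartedSpace H M] [IsManifold 𝓘(ℝ, H) 2 M]
  {E : Type*} [NormedAddCommGroup E] [InnerProductSpace ℝ E]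
  {I : Type*} {N : I → Type*}

/-- The restriction to the open set `U i` of the total map `Q i` is what matters: this is the
preimage of `S` under `Q i : U i → N i`. -/
def preimageOn (U : I → Set M) (Q : ∀ i, M → N i) (i : I) (S : Set (N i)) : Set M :=
  U i ∩ Q i ⁻¹' S

/-- A strong presentation `{U i, N i, Q i}` of the essential subbundle `𝓔` of `TM`. The maps
`Q i : U i → N i` are given by total maps, whose values outside `U i` are irrelevant. -/
structure IsStrongPresentation
    [∀ i, TopologicalSpace (N i)] [∀ i, ChartedSpace E (N i)] [∀ i, IsManifold 𝓘(ℝ, E) 2 (N i)]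
    (𝓔 : EssentialSubbundle H M) (U : I → Set M) (Q : ∀ i, M → N i) : Prop where
  isOpen : ∀ i, IsOpen (U i)
  covers : ⋃ i, U i = univ
  contMDiffOn : ∀ i, ContMDiffOn 𝓘(ℝ, H) 𝓘(ℝ, E) 1 (Q i) (U i)
  isSemiFredholm : ∀ i, ∀ p ∈ U i, IsSemiFredholm (mfderiv 𝓘(ℝ, H) 𝓘(ℝ, E) (Q i) p)
  index_eq : ∃ k : EReal, 0 ≤ k ∧ ∀ i, ∀ p ∈ U i,
    semiFredholmIndex (mfderiv 𝓘(ℝ, H) 𝓘(ℝ, E) (Q i) p) = k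
  ker_mem : ∀ i, ∀ p ∈ U i, ∃ V : ClosedSubmodule ℝ H,
    (∀ v : H, v ∈ V ↔ mfderiv 𝓘(ℝ, H) 𝓘(ℝ, E) (Q i) p v = 0) ∧ 𝓔.fiber p = essClass V
  precompact_iff : ∀ i j, ∀ A ⊆ U i ∩ U j,
    (IsCompact (closure (Q i '' A)) ↔ IsCompact (closure (Q j '' A)))

/-- The family of subsets of `M` that are covered by finitely many of the `U i` and whose image
under every `Q i : U i → N i` is pre-compact. -/
def verticalFamily [∀ i, TopologicalSpace (N i)] (U : I → Set M) (Q : ∀ i, M → N i) :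
    Set (Set M) :=
  {A | (∃ J : Set I, J.Finite ∧ A ⊆ ⋃ i ∈ J, U i) ∧
    ∀ i, IsCompact (closure (Q i '' (A ∩ U i)))}

variable [∀ i, EMetricSpace (N i)] [∀ i, ChartedSpace E (N i)]
  [∀ i, IsManifold 𝓘(ℝ, E) 2 (N i)]

/-- A strong presentation is admissible if the `N i` are complete Riemannian manifolds (the
Riemannian structure, with its distance, being part of the data), the covering is star-finite, and
it satisfies a uniformity condition with some radius `r > 0`. -/
structure IsAdmissiblePresentation
    [∀ i, RiemannianBundle (fun x : N i ↦ TangentSpace 𝓘(ℝ, E) x)]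
    (𝓔 : EssentialSubbundle H M) (U : I → Set M) (Q : ∀ i, M → N i) : Prop
    extends IsStrongPresentation (E := E) 𝓔 U Q where
  contMDiff_metric : ∀ i,
    IsContMDiffRiemannianBundle 𝓘(ℝ, E) 1 E (fun x : N i ↦ TangentSpace 𝓘(ℝ, E) x)
  edist_eq : ∀ i, IsRiemannianManifold 𝓘(ℝ, E) (N i)
  complete : ∀ i, CompleteSpace (N i)
  star_finite : ∀ i, {j | (U i ∩ U j).Nonempty}.Finite
  uniform : ∃ r : ℝ, 0 < r ∧ ∀ p : M, ∃ i, p ∈ U i ∧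
    closure (preimageOn U Q i (Metric.eball (Q i p) (ENNReal.ofReal r))) ⊆ U i

/-- The map `DQ i ∘ F : U i → T(N i)`. -/
def pushField (Q : ∀ i, M → N i) (F : ∀ p : M, TangentSpace 𝓘(ℝ, H) p) (i : I) (p : M) :
    TangentBundle 𝓘(ℝ, E) (N i) :=
  ⟨Q i p, mfderiv 𝓘(ℝ, H) 𝓘(ℝ, E) (Q i) p (F p)⟩

/-- Condition (C3): a uniform bound on `DQ i ∘ F`, and a local Lipschitz-type estimate for the
Hausdorff measures of non-compactness of `N i` and of `T(N i)` with its Sasaki distance. -/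
structure ConditionC3
    [∀ i, RiemannianBundle (fun x : N i ↦ TangentSpace 𝓘(ℝ, E) x)]
    (U : I → Set M) (Q : ∀ i, M → N i) (F : ∀ p : M, TangentSpace 𝓘(ℝ, H) p) : Prop where
  bounded : ∃ b : ℝ, 0 < b ∧ ∀ i, ∀ p ∈ U i,
    ‖(pushField (E := E) Q F i p).snd‖ ≤ b
  lipschitz : ∀ i, ∀ q : N i, ∃ δ : ℝ, 0 < δ ∧ ∃ c : ℝ≥0,
    ∀ A ⊆ preimageOn U Q i (Metric.eball q (ENNReal.ofReal δ)),
      hausdorffMNC sasakiEDist (pushField (E := E) Q F i '' A) ≤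
        (c : ℝ≥0∞) * hausdorffMNC edist (Q i '' A)

end Presentation

/-! ### Complete vector fields and their flow -/

section Flow

variable {H : Type*} [NormedAddCommGroup H] [NormedSpace ℝ H]
  {M : Type*} [TopologicalSpace M] [ChartedSpace H M]

/-- A vector field is complete if through each point there is an integral curve defined on `ℝ`. -/
def IsCompleteField (F : ∀ p : M, TangentSpace 𝓘(ℝ, H) p) : Prop :=
  ∀ p : M, ∃ γ : ℝ → M, γ 0 = p ∧ IsMIntegralCurve γ F

/-- The flow of a complete vector field: `t ↦ φ(t, p)` is the integral curve with `φ(0, p) = p`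
(it is unique when the field is `C¹` and the manifold is Hausdorff). -/
def flow {F : ∀ p : M, TangentSpace 𝓘(ℝ, H) p} (hF : IsCompleteField F) (t : ℝ) (p : M) : M :=
  (hF p).choose t

/-- A family `𝓕` of subsets of `M` is positively invariant for the flow `φ` if `φ([0, t] × A)`
belongs to `𝓕` for all `A ∈ 𝓕` and `t ≥ 0`. -/
def IsPositivelyInvariant (φ : ℝ → M → M) (𝓕 : Set (Set M)) : Prop :=
  ∀ A ∈ 𝓕, ∀ t : ℝ, 0 ≤ t → image2 φ (Icc 0 t) A ∈ 𝓕

end Flow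

end EssentialFlow

end

noncomputable section

namespace EssentialFlow

/-! ### Properties of the Hausdorff measure of non-compactness -/

section MNC

variable {X Y α : Type*}

/-! The proof is a Gronwall argument for the measure of non-compactness β, in small time steps. Let
`A` be the set swept during a time `s` by integral curves whose images under `f = Q i` start in a
compact set near `q`, and let μ = β(f(A)). In the chart at `q`, the mean value inequality bounds β
of the swept positions by `s` times β of the velocities (`hausdorffMNC_image2_le_of_hasDerivAt`).
The velocity coordinates are Lipschitz functions of the vectors for the Sasaki distance
(`exists_edist_fiber_le_sasakiEDist`), so (C3)(ii) bounds their β by a constant times μ. The inverse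
chart is Lipschitz for the Riemannian distance. Together these give μ ≤ const · s · μ with μ finite,
so μ = 0 for small `s` (`exists_totallyBounded_of_hausdorffMNC_le`).

The step `s` depends on `q`, but at each time finitely many `q` suffice, because the set swept so
far has compact closure. A continuity argument in time, closed by the speed bound `b`, propagates
total boundedness as long as the curves stay in one `U i`
(`totallyBounded_image2_of_isMIntegralCurve`). Completeness of `N i` turns it into pre-compactness.

The uniformity radius `r` and the speed bound keep each curve in a suitable `U i` for time `r / (2 *
b)` (`mem_of_closure_preimage_subset`). Star-finiteness leaves finitely many indices, and
pre-compactness passes from one index to the others. This time is the same for all sets of the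
family, so iteration reaches every `t`.

The geometric work lies in the Sasaki estimate. The covariant derivative is defined in a chart that
moves with the base point, so it must first be transported to a fixed chart through the
transformation law of the Christoffel symbols. -/

theorem exists_finite_cover_of_hausdorffMNC_lt {d : X → X → ℝ≥0∞} {A : Set X} {r : ℝ≥0∞}
    (h : hausdorffMNC d A < r) :
    0 < r ∧ ∃ C : Set X, C.Finite ∧ A ⊆ ⋃ x ∈ C, {y | d y x < r} := by
  obtain ⟨s, ⟨hs, C, hC, hA⟩, hsr⟩ := sInf_lt_iff.1 h
  refine ⟨hs.trans hsr, C, hC, hA.trans ?_⟩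
  exact iUnion₂_mono fun x _ y hy ↦ lt_trans hy hsr

theorem hausdorffMNC_le {d : X → X → ℝ≥0∞} {A : Set X} {r : ℝ≥0∞} (hr : 0 < r) {C : Set X}
    (hC : C.Finite) (hA : A ⊆ ⋃ x ∈ C, {y | d y x < r}) : hausdorffMNC d A ≤ r :=
  sInf_le ⟨hr, C, hC, hA⟩

theorem hausdorffMNC_le_of_subset_eball [PseudoEMetricSpace X] {A : Set X} {x : X} {r : ℝ≥0∞}
    (hr : 0 < r) (hA : A ⊆ Metric.eball x r) : hausdorffMNC edist A ≤ r :=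
  hausdorffMNC_le hr (finite_singleton x) fun y hy ↦ by
    simpa using Metric.mem_eball.1 (hA hy)

theorem totallyBounded_of_hausdorffMNC_eq_zero [PseudoEMetricSpace X] {A : Set X}
    (h : hausdorffMNC edist A = 0) : TotallyBounded A := by
  refine EMetric.totallyBounded_iff.2 fun ε hε ↦ ?_
  obtain ⟨-, C, hC, hA⟩ := exists_finite_cover_of_hausdorffMNC_lt (h.trans_lt hε)
  exact ⟨C, hC, hA⟩

/-- The factor 2 pays for recentring: the centre `y` of a ball need not come from `S`, where alone
the estimate is available, so it is replaced by some `g b` in the ball. -/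
theorem hausdorffMNC_image_le_mul [PseudoEMetricSpace X] [PseudoEMetricSpace Y]
    {f : α → X} {g : α → Y} {S : Set α} {C : ℝ≥0} (hC : 0 < C)
    (h : ∀ a ∈ S, ∀ b ∈ S, edist (f a) (f b) ≤ C * edist (g a) (g b)) :
    hausdorffMNC edist (f '' S) ≤ 2 * C * hausdorffMNC edist (g '' S) := by
  rcases S.eq_empty_or_nonempty with rfl | hS
  · refine le_of_forall_gt_imp_ge_of_dense fun r hr ↦ hausdorffMNC_le (bot_lt_of_lt hr)
      finite_empty (by simp)
  have hC0 : (2 * C : ℝ≥0∞) ≠ 0 := by simp [hC.ne']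
  have hCt : (2 * C : ℝ≥0∞) ≠ ⊤ := ENNReal.mul_ne_top (by simp) (by simp)
  rw [mul_comm, ← ENNReal.div_le_iff hC0 hCt]
  refine le_of_forall_gt_imp_ge_of_dense fun r hr ↦ ?_
  rw [ENNReal.div_le_iff hC0 hCt, mul_comm]
  obtain ⟨hr0, K, hK, hcov⟩ := exists_finite_cover_of_hausdorffMNC_lt hr
  rcases eq_or_ne r ⊤ with rfl | hrt
  · rw [ENNReal.mul_top hC0]; exact le_top
  have hsel : ∀ y : Y, ∃ z : X, ∀ a ∈ S, edist (g a) y < r → edist (f a) z < 2 * C * r := by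
    intro y
    by_cases hy : ∃ b ∈ S, edist (g b) y < r
    · obtain ⟨b, hb, hby⟩ := hy
      refine ⟨f b, fun a ha hay ↦ (h a ha b hb).trans_lt ?_⟩
      rw [mul_comm 2, mul_assoc, ENNReal.mul_lt_mul_iff_right (by simp [hC.ne']) ENNReal.coe_ne_top,
        two_mul]
      exact (edist_triangle_right _ _ y).trans_lt (ENNReal.add_lt_add hay hby)
    · exact ⟨f hS.some, fun a ha hay ↦ absurd ⟨a, ha, hay⟩ hy⟩
  choose c hc using hsel
  refine hausdorffMNC_le (pos_iff_ne_zero.2 (mul_ne_zero hC0 hr0.ne')) (hK.image c) ?_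
  rintro _ ⟨a, ha, rfl⟩
  obtain ⟨y, hy, hay⟩ := mem_iUnion₂.1 (hcov (mem_image_of_mem g ha))
  exact mem_iUnion₂.2 ⟨c y, mem_image_of_mem c hy, hc y a ha hay⟩

/-- The estimate allows arbitrary second points, so centres map to centres with no loss of a factor
2 and no triangle inequality for `d` or `d'`. This suits `sasakiEDist`, for which no distance axioms
are established. Coverings of radius below `ε` exist because `hausdorffMNC d S < ε`. -/
theorem hausdorffMNC_image_le_mul_of_lt {d : X → X → ℝ≥0∞} {d' : Y → Y → ℝ≥0∞} {f : X → Y}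
    {S : Set X} {C : ℝ≥0} (hC : 0 < C) {ε : ℝ≥0∞}
    (h : ∀ x ∈ S, ∀ y, d x y < ε → d' (f x) (f y) ≤ C * d x y) (hS : hausdorffMNC d S < ε) :
    hausdorffMNC d' (f '' S) ≤ C * hausdorffMNC d S := by
  have hC0 : (C : ℝ≥0∞) ≠ 0 := by simp [hC.ne']
  rw [mul_comm, ← ENNReal.div_le_iff hC0 ENNReal.coe_ne_top]
  refine le_of_forall_gt_imp_ge_of_dense fun r hr ↦ ?_
  wlog hrε : r < ε generalizing r
  · obtain ⟨s, hs, hsε⟩ := exists_between hS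
    exact (this s hs hsε).trans (hsε.le.trans (not_lt.1 hrε))
  rw [ENNReal.div_le_iff hC0 ENNReal.coe_ne_top, mul_comm]
  obtain ⟨hr0, K, hK, hcov⟩ := exists_finite_cover_of_hausdorffMNC_lt hr
  refine hausdorffMNC_le (by simp [hC, hr0]) (hK.image f) ?_
  rintro _ ⟨x, hx, rfl⟩
  obtain ⟨y, hy, hxy⟩ := mem_iUnion₂.1 (hcov hx)
  refine mem_iUnion₂.2 ⟨f y, mem_image_of_mem f hy, ?_⟩
  exact (h x hx y (lt_trans hxy hrε)).trans_lt
    ((ENNReal.mul_lt_mul_iff_right hC0 ENNReal.coe_ne_top).2 hxy)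

end MNC

/-! ### Mean value inequalities for families of curves -/

section MeanValue

open scoped Pointwise

variable {E : Type*} [NormedAddCommGroup E] [NormedSpace ℝ E]

/-- If the mean velocity were outside `Z`, a functional separating it strictly from `Z` would
violate the scalar mean value inequality. No integral is formed, so completeness of `E` plays no
role. -/
theorem sub_mem_smul_of_hasDerivAt {Z : Set E} (hZ : Convex ℝ Z) (hZc : IsClosed Z)
    {f f' : ℝ → E} {s : ℝ} (hs : 0 ≤ s) (hf : ∀ t ∈ Icc 0 s, HasDerivAt f (f' t) t)
    (hf' : ∀ t ∈ Icc 0 s, f' t ∈ Z) : f s - f 0 ∈ s • Z := by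
  rcases hs.eq_or_lt with rfl | hs
  · exact ⟨f' 0, hf' 0 (by simp), by simp⟩
  rw [mem_smul_set_iff_inv_smul_mem₀ hs.ne']
  by_contra hnot
  obtain ⟨l, u, hlu, hu⟩ := geometric_hahn_banach_closed_point hZ hZc hnot
  have hd : ∀ t ∈ Icc 0 s, HasDerivAt (fun t ↦ l (f t)) (l (f' t)) t := fun t ht ↦
    l.hasFDerivAt.comp_hasDerivAt t (hf t ht)
  have := (convex_Icc 0 s).image_sub_le_mul_sub_of_deriv_le
    (fun t ht ↦ (hd t ht).continuousAt.continuousWithinAt)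
    (fun t ht ↦ (hd t (interior_subset ht)).differentiableAt.differentiableWithinAt) (C := u)
    (fun t ht ↦ by
      rw [(hd t (interior_subset ht)).deriv]
      exact (hlu _ (hf' t (interior_subset ht))).le) 0 (by simp [hs.le]) s (by simp [hs.le]) hs.le
  rw [map_smul, map_sub, smul_eq_mul, lt_inv_mul_iff₀ hs] at hu
  linarith

/-- If finitely many balls of radius `r` cover the velocities, mean velocities lie in the closed
`r`-thickening of the convex hull of the centres. That hull is compact, so positions stay within `σ
* r` of the compact set `K₀ + [0, σ] • hull`, and a finite `ε`-net of the latter gives the covering.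
-/
theorem hausdorffMNC_image2_le_of_hasDerivAt {α : Type*} {x x' : α → ℝ → E} {S : Set α} {σ : ℝ}
    (hσ : 0 < σ) (hx : ∀ a ∈ S, ∀ t ∈ Icc 0 σ, HasDerivAt (x a) (x' a t) t) {K₀ : Set E}
    (hK₀ : IsCompact K₀) (hxK : ∀ a ∈ S, x a 0 ∈ K₀) :
    hausdorffMNC edist (image2 x S (Icc 0 σ)) ≤
      ENNReal.ofReal σ * hausdorffMNC edist (image2 x' S (Icc 0 σ)) := by
  have hσ0 : ENNReal.ofReal σ ≠ 0 := by simpa using hσ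
  rw [mul_comm, ← ENNReal.div_le_iff hσ0 ENNReal.ofReal_ne_top]
  refine le_of_forall_gt_imp_ge_of_dense fun r hr ↦ ?_
  rw [ENNReal.div_le_iff hσ0 ENNReal.ofReal_ne_top, mul_comm]
  obtain ⟨hr0, C, hC, hcov⟩ := exists_finite_cover_of_hausdorffMNC_lt hr
  rcases eq_or_ne r ⊤ with rfl | hrt
  · rw [ENNReal.mul_top hσ0]; exact le_top
  lift r to ℝ≥0 using hrt
  have hKc : IsCompact (convexHull ℝ C) := hC.isCompact_convexHull ℝ
  have hW : ∀ a ∈ S, ∀ t ∈ Icc 0 σ, x' a t ∈ Metric.cthickening r (convexHull ℝ C) := by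
    intro a ha t ht
    obtain ⟨c, hc, hlt⟩ := mem_iUnion₂.1 (hcov (mem_image2_of_mem ha ht))
    refine Metric.mem_cthickening_of_edist_le _ c _ _ (subset_convexHull ℝ C hc) ?_
    rw [ENNReal.ofReal_coe_nnreal]
    exact le_of_lt hlt
  have hT : IsCompact (K₀ + (fun z : ℝ × E ↦ z.1 • z.2) '' (Icc 0 σ ×ˢ convexHull ℝ C)) :=
    hK₀.add ((isCompact_Icc.prod hKc).image continuous_smul)
  refine ENNReal.le_of_forall_pos_le_add fun ε hε _ ↦ ?_
  obtain ⟨D, hD, hTD⟩ := EMetric.totallyBounded_iff.1 hT.totallyBounded ε (by simpa using hε)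
  refine hausdorffMNC_le (by positivity) hD ?_
  rintro _ ⟨a, ha, t, ht, rfl⟩
  have hmem := sub_mem_smul_of_hasDerivAt ((convex_convexHull ℝ C).cthickening r)
    Metric.isClosed_cthickening ht.1
    (fun s hs ↦ hx a ha s ⟨hs.1, hs.2.trans ht.2⟩) (fun s hs ↦ hW a ha s ⟨hs.1, hs.2.trans ht.2⟩)
  obtain ⟨z, hz, hzt⟩ := hmem
  rw [hKc.cthickening_eq_biUnion_closedBall r.coe_nonneg] at hz
  obtain ⟨k, hk, hzk⟩ := mem_iUnion₂.1 hz
  have hp : x a 0 + t • k ∈ K₀ + (fun z : ℝ × E ↦ z.1 • z.2) '' (Icc 0 σ ×ˢ convexHull ℝ C) :=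
    add_mem_add (hxK a ha) ⟨(t, k), ⟨ht, hk⟩, rfl⟩
  obtain ⟨y, hy, hpy⟩ := mem_iUnion₂.1 (hTD hp)
  refine mem_iUnion₂.2 ⟨y, hy, ?_⟩
  have h1 : edist (x a t) (x a 0 + t • k) ≤ ENNReal.ofReal σ * r := by
    have : x a t = x a 0 + t • z := by
      have : t • z = x a t - x a 0 := hzt
      rw [this]; abel
    rw [this, edist_add_left, edist_dist, dist_smul₀, Real.norm_of_nonneg ht.1,
      ENNReal.ofReal_mul ht.1]
    gcongr
    · exact ht.2
    · exact ENNReal.ofReal_le_of_le_toReal (by simpa using hzk)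
  exact (edist_triangle _ (x a 0 + t • k) _).trans_lt
    (ENNReal.add_lt_add_of_le_of_lt (ne_top_of_le_ne_top
      (ENNReal.mul_ne_top ENNReal.ofReal_ne_top ENNReal.coe_ne_top) h1) h1 hpy)

end MeanValue

/-! ### Velocities of curves in charts -/

section Velocity

variable {E : Type*} [NormedAddCommGroup E] [NormedSpace ℝ E]
  {N : Type*} [TopologicalSpace N] [ChartedSpace E N]

theorem hasMFDerivAt_smulRight {γ : ℝ → N} {t : ℝ}
    (hγ : MDifferentiableAt 𝓘(ℝ, ℝ) 𝓘(ℝ, E) γ t) :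
    HasMFDerivAt 𝓘(ℝ, ℝ) 𝓘(ℝ, E) γ t
      ((1 : ℝ →L[ℝ] ℝ).smulRight (mfderiv 𝓘(ℝ, ℝ) 𝓘(ℝ, E) γ t (1 : ℝ))) := by
  refine hγ.hasMFDerivAt.congr_mfderiv (ContinuousLinearMap.ext fun (r : ℝ) ↦ ?_)
  have := (mfderiv 𝓘(ℝ, ℝ) 𝓘(ℝ, E) γ t).map_smul r (1 : ℝ)
  have e : r • (1 : ℝ) = r := mul_one r
  exact (congrArg (mfderiv 𝓘(ℝ, ℝ) 𝓘(ℝ, E) γ t) e.symm).trans this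

variable [IsManifold 𝓘(ℝ, E) 1 N]

theorem hasDerivAt_extChartAt_comp {γ : ℝ → N} {t : ℝ} {q : N} {v : TangentSpace 𝓘(ℝ, E) (γ t)}
    (hγ : HasMFDerivAt 𝓘(ℝ, ℝ) 𝓘(ℝ, E) γ t ((1 : ℝ →L[ℝ] ℝ).smulRight v))
    (hq : γ t ∈ (chartAt E q).source) :
    HasDerivAt (fun s ↦ extChartAt 𝓘(ℝ, E) q (γ s))
      ((trivializationAt E (fun z : N ↦ TangentSpace 𝓘(ℝ, E) z) q).continuousLinearMapAt ℝ
        (γ t) v) t := by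
  have h := (mdifferentiableAt_extChartAt (I := 𝓘(ℝ, E)) hq).hasMFDerivAt.comp t hγ
  rw [← TangentBundle.continuousLinearMapAt_trivializationAt hq] at h
  have h' : HasFDerivAt (𝕜 := ℝ) (E := ℝ) (F := E) (fun s ↦ extChartAt 𝓘(ℝ, E) q (γ s)) _ t :=
    hasMFDerivAt_iff_hasFDerivAt.1 h
  refine h'.hasDerivAt.congr_deriv ?_
  exact congrArg _ (one_smul ℝ v)

theorem mfderiv_eq_symmL_deriv {γ : ℝ → N} {t : ℝ} {q : N}
    (hγ : MDifferentiableAt 𝓘(ℝ, ℝ) 𝓘(ℝ, E) γ t) (hq : γ t ∈ (chartAt E q).source) :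
    mfderiv 𝓘(ℝ, ℝ) 𝓘(ℝ, E) γ t (1 : ℝ) =
      (trivializationAt E (fun z : N ↦ TangentSpace 𝓘(ℝ, E) z) q).symmL ℝ (γ t)
        (deriv (fun s ↦ extChartAt 𝓘(ℝ, E) q (γ s)) t) := by
  rw [(hasDerivAt_extChartAt_comp (hasMFDerivAt_smulRight hγ) hq).deriv,
    Trivialization.symmL_continuousLinearMapAt _ (by simpa using hq)]

end Velocity

/-! ### The Riemannian distance near a point -/

section Distance

variable {E : Type*} [NormedAddCommGroup E] [NormedSpace ℝ E]
  {N : Type*} [TopologicalSpace N] [ChartedSpace E N]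
  [RiemannianBundle (fun x : N ↦ TangentSpace 𝓘(ℝ, E) x)]

theorem riemannianEDist_le_of_norm_mfderiv_le {γ : ℝ → N} {s t b : ℝ} (hst : s ≤ t) (hb : 0 ≤ b)
    (hγ : ContMDiffOn 𝓘(ℝ, ℝ) 𝓘(ℝ, E) 1 γ (Icc s t))
    (hbd : ∀ u ∈ Ioo s t, ‖mfderiv 𝓘(ℝ, ℝ) 𝓘(ℝ, E) γ u (1 : ℝ)‖ ≤ b) :
    riemannianEDist 𝓘(ℝ, E) (γ s) (γ t) ≤ ENNReal.ofReal (b * (t - s)) := by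
  refine (riemannianEDist_le_pathELength hγ rfl rfl hst).trans ?_
  rw [pathELength_eq_lintegral_mfderiv_Ioo]
  calc ∫⁻ u in Ioo s t, ‖mfderiv 𝓘(ℝ, ℝ) 𝓘(ℝ, E) γ u (1 : ℝ)‖ₑ
      ≤ ∫⁻ _ in Ioo s t, ENNReal.ofReal b := by
        refine setLIntegral_mono' measurableSet_Ioo fun u hu ↦ ?_
        rw [← ofReal_norm]
        exact ENNReal.ofReal_le_ofReal (hbd u hu)
    _ = ENNReal.ofReal (b * (t - s)) := by
        rw [setLIntegral_const, Real.volume_Ioo, ENNReal.ofReal_mul hb]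

variable [IsManifold 𝓘(ℝ, E) 1 N]
  [IsContinuousRiemannianBundle E (fun x : N ↦ TangentSpace 𝓘(ℝ, E) x)]

/-- The inverse of a chart is locally Lipschitz for the Riemannian distance. -/
theorem exists_nhds_riemannianEDist_le_edist_extChartAt (x : N) :
    ∃ C > (0 : ℝ≥0), ∃ W ∈ 𝓝 x, ∀ y ∈ W, ∀ z ∈ W,
      riemannianEDist 𝓘(ℝ, E) y z ≤
        C * edist (extChartAt 𝓘(ℝ, E) x y) (extChartAt 𝓘(ℝ, E) x z) := by
  obtain ⟨C, C_pos, hC⟩ :=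
    eventually_norm_symmL_trivializationAt_lt E (fun x : N ↦ TangentSpace 𝓘(ℝ, E) x) x
  have hC' : ∀ᶠ y in 𝓝 (extChartAt 𝓘(ℝ, E) x x), y ∈ (extChartAt 𝓘(ℝ, E) x).target ∧
      ‖(trivializationAt E (fun z : N ↦ TangentSpace 𝓘(ℝ, E) z) x).symmL ℝ
        ((extChartAt 𝓘(ℝ, E) x).symm y)‖ < C := by
    refine Eventually.and (extChartAt_target_mem_nhds (I := 𝓘(ℝ, E)) x) ?_
    have h := continuousAt_extChartAt_symm (I := 𝓘(ℝ, E)) x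
    rw [ContinuousAt, extChartAt_to_inv] at h
    exact h.eventually hC
  obtain ⟨r, r_pos, hr⟩ := Metric.eventually_nhds_iff_ball.1 hC'
  have A : (extChartAt 𝓘(ℝ, E) x) ⁻¹' Metric.ball (extChartAt 𝓘(ℝ, E) x x) r ∈ 𝓝 x :=
    (continuousAt_extChartAt x).preimage_mem_nhds (Metric.ball_mem_nhds _ r_pos)
  refine ⟨C.toNNReal, Real.toNNReal_pos.2 C_pos, _, inter_mem A (chart_source_mem_nhds E x), ?_⟩
  rintro y ⟨hy, h'y⟩ z ⟨hz, h'z⟩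
  let a := extChartAt 𝓘(ℝ, E) x y
  let b := extChartAt 𝓘(ℝ, E) x z
  -- The competitor for the distance is the straight segment in the chart; convexity keeps it in the
  -- ball where the inverse trivialization has norm below `C`.
  let η : ℝ → E := fun t ↦ a + t • (b - a)
  have hηball : ∀ t ∈ Icc (0 : ℝ) 1, η t ∈ Metric.ball (extChartAt 𝓘(ℝ, E) x x) r :=
    fun t ht ↦ (convex_ball _ _).add_smul_sub_mem hy hz ht
  have hηd : ∀ t, HasDerivAt η (b - a) t := fun t ↦ by
    have := ((hasDerivAt_id t).smul_const (b - a)).const_add a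
    rwa [one_smul] at this
  have hηs : ContMDiffOn 𝓘(ℝ, ℝ) 𝓘(ℝ, E) 1 η (Icc 0 1) := by
    rw [contMDiffOn_iff_contDiffOn]
    exact (contDiff_const.add (contDiff_id.smul contDiff_const)).contDiffOn
  let γ : ℝ → N := fun t ↦ (extChartAt 𝓘(ℝ, E) x).symm (η t)
  have hγ : ContMDiffOn 𝓘(ℝ, ℝ) 𝓘(ℝ, E) 1 γ (Icc 0 1) :=
    (contMDiffOn_extChartAt_symm x).comp hηs fun t ht ↦ (hr _ (hηball t ht)).1
  have hγ0 : γ 0 = y := by simp [γ, η, a, h'y]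
  have hγ1 : γ 1 = z := by simp [γ, η, a, b, h'z]
  have hbd : ∀ u ∈ Ioo (0 : ℝ) 1,
      ‖mfderiv 𝓘(ℝ, ℝ) 𝓘(ℝ, E) γ u (1 : ℝ)‖ ≤ C * ‖b - a‖ := by
    intro u hu
    have hsrc : γ u ∈ (chartAt E x).source := by
      rw [← extChartAt_source 𝓘(ℝ, E)]
      exact (extChartAt 𝓘(ℝ, E) x).map_target (hr _ (hηball u (Ioo_subset_Icc_self hu))).1
    have heq : (fun s ↦ extChartAt 𝓘(ℝ, E) x (γ s)) =ᶠ[𝓝 u] η := by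
      filter_upwards [Icc_mem_nhds hu.1 hu.2] with s hs
      exact (extChartAt 𝓘(ℝ, E) x).right_inv (hr _ (hηball s hs)).1
    rw [mfderiv_eq_symmL_deriv (((hγ.contMDiffAt (Icc_mem_nhds hu.1 hu.2)).mdifferentiableAt
      one_ne_zero)) hsrc, heq.deriv_eq, (hηd u).deriv]
    exact ContinuousLinearMap.le_of_opNorm_le _
      (hr _ (hηball u (Ioo_subset_Icc_self hu))).2.le _
  have := riemannianEDist_le_of_norm_mfderiv_le zero_le_one (by positivity) hγ hbd
  rw [hγ0, hγ1, sub_zero, mul_one, ENNReal.ofReal_mul C_pos.le, ← dist_eq_norm, dist_comm,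
    ← edist_dist] at this
  exact this

end Distance

/-! ### The coefficients of a Riemannian metric in a chart -/

section BundleMetric

variable {EB : Type*} [NormedAddCommGroup EB] [NormedSpace ℝ EB]
  {HB : Type*} [TopologicalSpace HB] {IB : ModelWithCorners ℝ EB HB} {n : WithTop ℕ∞}
  {B : Type*} [TopologicalSpace B] [ChartedSpace HB B]
  {F : Type*} [NormedAddCommGroup F] [NormedSpace ℝ F]
  {V : B → Type*} [TopologicalSpace (TotalSpace F V)] [∀ x, NormedAddCommGroup (V x)]
  [∀ x, InnerProductSpace ℝ (V x)] [FiberBundle F V] [VectorBundle ℝ F V]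

/-- The regularity is that of an operator-valued map, stronger than regularity of each coefficient;
it is what bounds the derivative of the metric uniformly in the vectors. -/
theorem exists_contMDiffAt_metric_coefficients [h : IsContMDiffRiemannianBundle IB n F V] (x : B) :
    ∃ G : B → F →L[ℝ] F →L[ℝ] ℝ, ContMDiffAt IB 𝓘(ℝ, F →L[ℝ] F →L[ℝ] ℝ) n G x ∧
      ∀ b ∈ (trivializationAt F V x).baseSet, ∀ u w : F,
        inner ℝ ((trivializationAt F V x).symm b u) ((trivializationAt F V x).symm b w) =
          G b u w := by
  obtain ⟨g, hgs, hg⟩ := h.exists_contMDiff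
  refine ⟨fun b ↦ ContinuousLinearMap.inCoordinates F V (F →L[ℝ] ℝ) (fun x ↦ V x →L[ℝ] ℝ)
    x b x b (g b), ?_, fun b hb u w ↦ ?_⟩
  · have := hgs.contMDiffAt (x := x)
    rw [contMDiffAt_hom_bundle] at this
    exact this.2
  · rw [inCoordinates_apply_eq₂ hb hb (Set.mem_univ _), hg]
    simp

end BundleMetric

section Metric

variable {E : Type*} [NormedAddCommGroup E] [InnerProductSpace ℝ E]
  {N : Type*} [TopologicalSpace N] [ChartedSpace E N] [IsManifold 𝓘(ℝ, E) 2 N]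
  [RiemannianBundle (fun x : N ↦ TangentSpace 𝓘(ℝ, E) x)]

theorem exists_contDiffAt_metricInChart
    [IsContMDiffRiemannianBundle 𝓘(ℝ, E) 1 E (fun x : N ↦ TangentSpace 𝓘(ℝ, E) x)] (q : N) :
    ∃ G : E → E →L[ℝ] E →L[ℝ] ℝ, ContDiffAt ℝ 1 G (extChartAt 𝓘(ℝ, E) q q) ∧
      ∀ y ∈ (extChartAt 𝓘(ℝ, E) q).target, ∀ u w, metricInChart q y u w = G y u w := by
  obtain ⟨G, hG, hGq⟩ := exists_contMDiffAt_metric_coefficients (IB := 𝓘(ℝ, E)) (n := 1) (F := E)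
    (V := fun x : N ↦ TangentSpace 𝓘(ℝ, E) x) q
  refine ⟨fun y ↦ G ((extChartAt 𝓘(ℝ, E) q).symm y), ?_, fun y hy u w ↦ hGq _ ?_ u w⟩
  · rw [← contMDiffAt_iff_contDiffAt]
    refine ContMDiffAt.comp_of_eq (y := q) hG ?_ (by simp)
    exact ((contMDiffOn_extChartAt_symm (n := 1) q).contMDiffAt (extChartAt_target_mem_nhds q))
  · rw [TangentBundle.trivializationAt_baseSet, ← extChartAt_source 𝓘(ℝ, E)]
    exact (extChartAt 𝓘(ℝ, E) q).map_target hy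

end Metric

/-! ### Change of coordinates -/

section CoordChange

variable {E : Type*} [NormedAddCommGroup E] [NormedSpace ℝ E]

/-- The operator norm on bilinear forms, as a shortcut for instance search. -/
abbrev bilinNormedAddCommGroup : NormedAddCommGroup (E →L[ℝ] E →L[ℝ] ℝ) :=
  ContinuousLinearMap.toNormedAddCommGroup

/-- The normed space of bilinear forms, as a shortcut for instance search. -/
abbrev bilinNormedSpace : NormedSpace ℝ (E →L[ℝ] E →L[ℝ] ℝ) :=
  ContinuousLinearMap.toNormedSpace

attribute [local instance] bilinNormedAddCommGroup bilinNormedSpace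

theorem fderiv_bilin_comp_apply {G : E → E →L[ℝ] E →L[ℝ] ℝ} {G' : E →L[ℝ] E →L[ℝ] E →L[ℝ] ℝ}
    {ψ : E → E} {P : E → E →L[ℝ] E} {P' : E →L[ℝ] E →L[ℝ] E} {a : E}
    (hG : HasFDerivAt G G' (ψ a)) (hψ : HasFDerivAt ψ (P a) a) (hP : HasFDerivAt P P' a)
    (u w z : E) :
    fderiv ℝ (fun y ↦ G (ψ y) (P y u) (P y w)) a z =
      G' (P a z) (P a u) (P a w) + G (ψ a) (P' z u) (P a w) + G (ψ a) (P a u) (P' z w) := by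
  have h1 : ∀ v, HasFDerivAt (fun y ↦ P y v) (P'.flip v) a := fun v ↦ by
    simpa using hP.clm_apply (hasFDerivAt_const v a)
  have h2 := ((hG.comp a hψ).clm_apply (h1 u)).clm_apply (h1 w)
  have h3 := h2.fderiv
  simp only [Function.comp_apply] at h3
  rw [h3]
  simp
  ring

/-- Each of the three derivatives produces two terms with `P'`. By symmetry of `P'` (a second
derivative) and of `G`, four of the six cancel in pairs and the other two coincide, leaving the
single non-tensorial term `G (ψ a) (P' z v) (P a w)`. -/
theorem christoffel_transformation {G : E → E →L[ℝ] E →L[ℝ] ℝ} {G' : E →L[ℝ] E →L[ℝ] E →L[ℝ] ℝ}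
    {ψ : E → E} {P : E → E →L[ℝ] E} {P' : E →L[ℝ] E →L[ℝ] E} {a : E}
    (hG : HasFDerivAt G G' (ψ a)) (hψ : ∀ᶠ y in 𝓝 a, HasFDerivAt ψ (P y) y)
    (hP : HasFDerivAt P P' a) (hsymm : ∀ u w, G (ψ a) u w = G (ψ a) w u)
    {g : E → E → E → ℝ} (hg : ∀ u w, ∀ᶠ y in 𝓝 a, g y u w = G (ψ y) (P y u) (P y w))
    (z v w : E) :
    (fderiv ℝ (fun y ↦ g y v w) a z + fderiv ℝ (fun y ↦ g y z w) a v
        - fderiv ℝ (fun y ↦ g y z v) a w) / 2 =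
      (G' (P a z) (P a v) (P a w) + G' (P a v) (P a z) (P a w) - G' (P a w) (P a z) (P a v)) / 2
        + G (ψ a) (P' z v) (P a w) := by
  have hd : ∀ u w z, fderiv ℝ (fun y ↦ g y u w) a z = G' (P a z) (P a u) (P a w) +
      G (ψ a) (P' z u) (P a w) + G (ψ a) (P a u) (P' z w) := fun u w z ↦ by
    rw [Filter.EventuallyEq.fderiv_eq (hg u w), fderiv_bilin_comp_apply hG hψ.self_of_nhds hP]
  have hs := second_derivative_symmetric_of_eventually hψ hP
  rw [hd, hd, hd, hs v z, hs w z, hs w v, hsymm (P a z) (P' v w), hsymm (P a v) (P' z w)]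
  ring

end CoordChange

/-! ### The covariant derivative in a fixed chart -/

section Transition

variable {E : Type*} [NormedAddCommGroup E] [NormedSpace ℝ E]
  {N : Type*} [TopologicalSpace N] [ChartedSpace E N]

theorem transition_source_mem_nhds {q x : N} (hx : x ∈ (chartAt E q).source) :
    ((extChartAt 𝓘(ℝ, E) x).symm.trans (extChartAt 𝓘(ℝ, E) q)).source ∈
      𝓝 (extChartAt 𝓘(ℝ, E) x x) := by
  rw [PartialEquiv.trans_source, PartialEquiv.symm_source]
  refine inter_mem (extChartAt_target_mem_nhds x)
    ((continuousAt_extChartAt_symm x).preimage_mem_nhds ?_)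
  rw [extChartAt_to_inv]
  exact extChartAt_source_mem_nhds' (by simpa using hx)

theorem contDiffAt_transition {n : WithTop ℕ∞} [IsManifold 𝓘(ℝ, E) n N] {q x : N}
    (hx : x ∈ (chartAt E q).source) :
    ContDiffAt ℝ n (extChartAt 𝓘(ℝ, E) q ∘ (extChartAt 𝓘(ℝ, E) x).symm)
      (extChartAt 𝓘(ℝ, E) x x) :=
  (contDiffOn_ext_coord_change q x).contDiffAt (transition_source_mem_nhds hx)

variable [IsManifold 𝓘(ℝ, E) 1 N]

theorem fderiv_transition (q x p : N) :
    fderiv ℝ (extChartAt 𝓘(ℝ, E) q ∘ (extChartAt 𝓘(ℝ, E) x).symm) (extChartAt 𝓘(ℝ, E) x p) =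
      tangentCoordChange 𝓘(ℝ, E) x q p := by
  rw [tangentCoordChange_def, ModelWithCorners.range_eq_univ, fderivWithin_univ]

theorem trivializationAt_symm_eq_tangentCoordChange {q p : N} (hp : p ∈ (chartAt E q).source)
    (u : E) :
    (trivializationAt E (fun z : N ↦ TangentSpace 𝓘(ℝ, E) z) q).symm p u =
      tangentCoordChange 𝓘(ℝ, E) q p p u := by
  rw [← Trivialization.symmL_apply (R := ℝ) _ (by simpa using hp),
    TangentBundle.symmL_trivializationAt_eq_core hp]
  rfl

theorem trivializationAt_snd_eq_fderiv_transition {q x : N} (ξ : TangentBundle 𝓘(ℝ, E) N)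
    (hx : ξ.proj ∈ (chartAt E x).source) (hq : ξ.proj ∈ (chartAt E q).source) :
    (trivializationAt E (fun z : N ↦ TangentSpace 𝓘(ℝ, E) z) q ξ).2 =
      fderiv ℝ (extChartAt 𝓘(ℝ, E) q ∘ (extChartAt 𝓘(ℝ, E) x).symm)
        (extChartAt 𝓘(ℝ, E) x ξ.proj)
        (trivializationAt E (fun z : N ↦ TangentSpace 𝓘(ℝ, E) z) x ξ).2 := by
  rw [fderiv_transition]
  exact (tangentCoordChange_comp (by simp [hx, hq])).symm

end Transition

/-! ### The metric and the covariant derivative under a change of chart. -/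

section Metric

variable {E : Type*} [NormedAddCommGroup E] [InnerProductSpace ℝ E]
  {N : Type*} [TopologicalSpace N] [ChartedSpace E N] [IsManifold 𝓘(ℝ, E) 2 N]
  [RiemannianBundle (fun x : N ↦ TangentSpace 𝓘(ℝ, E) x)]

theorem metricInChart_extChartAt {q p : N} (hp : p ∈ (chartAt E q).source) (u w : E) :
    metricInChart q (extChartAt 𝓘(ℝ, E) q p) u w =
      inner ℝ ((trivializationAt E (fun z : N ↦ TangentSpace 𝓘(ℝ, E) z) q).symm p u)
        ((trivializationAt E (fun z : N ↦ TangentSpace 𝓘(ℝ, E) z) q).symm p w) := by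
  have h : (extChartAt 𝓘(ℝ, E) q).symm (extChartAt 𝓘(ℝ, E) q p) = p :=
    (extChartAt 𝓘(ℝ, E) q).left_inv (by simpa using hp)
  simp only [metricInChart]
  rw [h]

theorem metricInChart_comm (q : N) (y u w : E) :
    metricInChart q y u w = metricInChart q y w u :=
  real_inner_comm _ _

/-- Both sides are inner products of the same tangent vectors at the same point; this is the cocycle
identity of `tangentCoordChange`. -/
theorem metricInChart_transition {q x : N} {y : E}
    (hy : y ∈ ((extChartAt 𝓘(ℝ, E) x).symm.trans (extChartAt 𝓘(ℝ, E) q)).source) (u w : E) :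
    metricInChart x y u w =
      metricInChart q ((extChartAt 𝓘(ℝ, E) q ∘ (extChartAt 𝓘(ℝ, E) x).symm) y)
        (fderiv ℝ (extChartAt 𝓘(ℝ, E) q ∘ (extChartAt 𝓘(ℝ, E) x).symm) y u)
        (fderiv ℝ (extChartAt 𝓘(ℝ, E) q ∘ (extChartAt 𝓘(ℝ, E) x).symm) y w) := by
  rw [PartialEquiv.trans_source, PartialEquiv.symm_source] at hy
  obtain ⟨hyt, hyq⟩ := hy
  obtain ⟨p, hp, rfl⟩ : ∃ p ∈ (chartAt E x).source, extChartAt 𝓘(ℝ, E) x p = y :=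
    ⟨(extChartAt 𝓘(ℝ, E) x).symm y, by
      simpa using (extChartAt 𝓘(ℝ, E) x).map_target hyt, (extChartAt 𝓘(ℝ, E) x).right_inv hyt⟩
  have hinv := (extChartAt 𝓘(ℝ, E) x).left_inv (x := p) (by simpa using hp)
  have hpq : p ∈ (chartAt E q).source := by simpa [hp] using hyq
  have key : ∀ u, tangentCoordChange 𝓘(ℝ, E) q p p (tangentCoordChange 𝓘(ℝ, E) x q p u) =
      tangentCoordChange 𝓘(ℝ, E) x p p u := fun u ↦ tangentCoordChange_comp (by simp [hp, hpq])
  rw [Function.comp_apply, hinv, metricInChart_extChartAt hp, metricInChart_extChartAt hpq,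
    fderiv_transition]
  simp only [trivializationAt_symm_eq_tangentCoordChange hp,
    trivializationAt_symm_eq_tangentCoordChange hpq, key]

theorem metricInChart_extChartAt_self (x : N) (u w : TangentSpace 𝓘(ℝ, E) x) :
    metricInChart x (extChartAt 𝓘(ℝ, E) x x) u w = inner ℝ u w := by
  have h : ∀ u : TangentSpace 𝓘(ℝ, E) x,
      (trivializationAt E (fun z : N ↦ TangentSpace 𝓘(ℝ, E) z) x).symm x u = u := fun u ↦
    (trivializationAt_symm_eq_tangentCoordChange (mem_chart_source E x) u).trans
      (tangentCoordChange_self (I := 𝓘(ℝ, E)) (mem_extChartAt_source x))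
  exact (metricInChart_extChartAt (mem_chart_source E x) u w).trans
    (congrArg₂ (inner ℝ) (h u) (h w))

attribute [local instance] bilinNormedAddCommGroup bilinNormedSpace

/-- Transformation law of `g(ν + Γ(z, v), w)` from the chart at `x` to the chart at `q`. -/
theorem metricInChart_add_christoffelFirst {q x : N} (hq : x ∈ (chartAt E q).source)
    {G : E → E →L[ℝ] E →L[ℝ] ℝ} {G' : E →L[ℝ] E →L[ℝ] E →L[ℝ] ℝ}
    (hG : HasFDerivAt G G' (extChartAt 𝓘(ℝ, E) q x))
    (hGq : ∀ y ∈ (extChartAt 𝓘(ℝ, E) q).target, ∀ u w, metricInChart q y u w = G y u w)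
    {P : E →L[ℝ] E} {P' : E →L[ℝ] E →L[ℝ] E}
    (hP : fderiv ℝ (extChartAt 𝓘(ℝ, E) q ∘ (extChartAt 𝓘(ℝ, E) x).symm)
      (extChartAt 𝓘(ℝ, E) x x) = P)
    (hP' : HasFDerivAt (fderiv ℝ (extChartAt 𝓘(ℝ, E) q ∘ (extChartAt 𝓘(ℝ, E) x).symm)) P'
      (extChartAt 𝓘(ℝ, E) x x)) (ν z v w : E) :
    metricInChart x (extChartAt 𝓘(ℝ, E) x x) ν w + christoffelFirst x z v w =
      G (extChartAt 𝓘(ℝ, E) q x) (P' z v + P ν) (P w) +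
        (G' (P z) (P v) (P w) + G' (P v) (P z) (P w) - G' (P w) (P z) (P v)) / 2 := by
  set a := extChartAt 𝓘(ℝ, E) x x with ha
  set ψ := extChartAt 𝓘(ℝ, E) q ∘ (extChartAt 𝓘(ℝ, E) x).symm with hψ
  have hψa : ψ a = extChartAt 𝓘(ℝ, E) q x := by simp [hψ, ha]
  have hψ2 : ContDiffAt ℝ 2 ψ a := contDiffAt_transition hq
  have hψd : ∀ᶠ y in 𝓝 a, HasFDerivAt ψ (fderiv ℝ ψ y) y := by
    filter_upwards [hψ2.eventually (by simp)] with y hy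
    exact (hy.differentiableAt (by simp)).hasFDerivAt
  have hbt : extChartAt 𝓘(ℝ, E) q x ∈ (extChartAt 𝓘(ℝ, E) q).target :=
    (extChartAt 𝓘(ℝ, E) q).map_source (by simpa using hq)
  have hmet : ∀ u w, ∀ᶠ y in 𝓝 a,
      metricInChart x y u w = G (ψ y) (fderiv ℝ ψ y u) (fderiv ℝ ψ y w) := by
    intro u w
    filter_upwards [transition_source_mem_nhds hq] with y hy
    rw [metricInChart_transition hy u w]
    refine hGq _ ?_ _ _
    exact (extChartAt 𝓘(ℝ, E) q).map_source hy.2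
  have hsymm : ∀ u w, G (ψ a) u w = G (ψ a) w u := fun u w ↦ by
    rw [hψa, ← hGq _ hbt, ← hGq _ hbt, metricInChart_comm]
  have hchr := christoffel_transformation (hψa ▸ hG) hψd hP' hsymm hmet z v w
  rw [(hmet ν w).self_of_nhds, christoffelFirst]
  simp only [metricDeriv]
  rw [hchr, hP, hψa, map_add, add_apply]
  ring

/-- The covariant derivative of a curve in the tangent bundle, read in the chart at a fixed
point `q`. -/
theorem IsCovariantDerivative.inner_eq_in_chart {c : ℝ → TangentBundle 𝓘(ℝ, E) N}
    {D : ∀ t : ℝ, TangentSpace 𝓘(ℝ, E) (c t).proj} (hD : IsCovariantDerivative c D) {t : ℝ}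
    (ht : t ∈ Ioo (0 : ℝ) 1)
    (hc : ContMDiffAt 𝓘(ℝ, ℝ) 𝓘(ℝ, E).tangent 1 c t) {q : N}
    (hq : (c t).proj ∈ (chartAt E q).source)
    {G : E → E →L[ℝ] E →L[ℝ] ℝ} {G' : E →L[ℝ] E →L[ℝ] E →L[ℝ] ℝ}
    (hG : HasFDerivAt G G' (extChartAt 𝓘(ℝ, E) q (c t).proj))
    (hGq : ∀ y ∈ (extChartAt 𝓘(ℝ, E) q).target, ∀ u w, metricInChart q y u w = G y u w)
    {z v v' : E} (hz : HasDerivAt (fun s ↦ extChartAt 𝓘(ℝ, E) q (c s).proj) z t)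
    (hv : (trivializationAt E (fun z : N ↦ TangentSpace 𝓘(ℝ, E) z) q (c t)).2 = v)
    (hv' : HasDerivAt
      (fun s ↦ (trivializationAt E (fun z : N ↦ TangentSpace 𝓘(ℝ, E) z) q (c s)).2) v' t)
    (w : E) :
    inner ℝ (D t) ((trivializationAt E (fun z : N ↦ TangentSpace 𝓘(ℝ, E) z) q).symm
      (c t).proj w) =
    G (extChartAt 𝓘(ℝ, E) q (c t).proj) v' w + (G' z v w + G' v z w - G' w z v) / 2 := by
  obtain ⟨hcb, hcv⟩ := contMDiffAt_totalSpace.1 hc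
  have hψ2 : ContDiffAt ℝ 2 (extChartAt 𝓘(ℝ, E) q ∘ (extChartAt 𝓘(ℝ, E) (c t).proj).symm)
    (extChartAt 𝓘(ℝ, E) (c t).proj (c t).proj) := contDiffAt_transition hq
  have hψ := (hψ2.differentiableAt (by simp)).hasFDerivAt
  have hP := ((hψ2.fderiv_right (m := 1) (by norm_num)).differentiableAt (by simp)).hasFDerivAt
  have hbase : HasDerivAt (fun s ↦ extChartAt 𝓘(ℝ, E) (c t).proj (c s).proj)
      (baseVelocity c t : E) t := by
    have hcb' := hcb.mdifferentiableAt one_ne_zero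
    have h : HasMFDerivAt 𝓘(ℝ, ℝ) 𝓘(ℝ, E) (fun s ↦ (c s).proj) t
        ((1 : ℝ →L[ℝ] ℝ).smulRight (baseVelocity c t)) := hasMFDerivAt_smulRight hcb'
    refine (hasDerivAt_extChartAt_comp h (mem_chart_source E (c t).proj)).congr_deriv ?_
    rw [TangentBundle.continuousLinearMapAt_trivializationAt_eq_core
      (mem_chart_source E (c t).proj)]
    exact tangentCoordChange_self (I := 𝓘(ℝ, E)) (mem_extChartAt_source _)
  have hfib : HasDerivAt (fun s ↦ fiberCoord c t s) (fiberVelocity c t : E) t :=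
    (hcv.contDiffAt.differentiableAt (by simp)).hasDerivAt
  have hsrc : ∀ᶠ s in 𝓝 t, (c s).proj ∈ (chartAt E (c t).proj).source ∧
      (c s).proj ∈ (chartAt E q).source := by
    refine hcb.continuousAt.eventually (Eventually.and ?_ ?_)
    · exact chart_source_mem_nhds E _
    · exact (chartAt E q).open_source.mem_nhds hq
  have hz' := hz.unique ((hψ.comp_hasDerivAt t hbase).congr_of_eventuallyEq (by
    filter_upwards [hsrc] with s hs
    simp [hs.1]))
  have hvv := trivializationAt_snd_eq_fderiv_transition (c t) (mem_chart_source E (c t).proj) hq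
  -- Differentiating `v_q = Dψ(γ) v_x` gives `D²ψ(γ', v_x) + Dψ(γ) v_x'`: its first term is exactly
  -- the inhomogeneous term of the Christoffel law.
  have hvd := hv'.unique (((hP.comp_hasDerivAt t hbase).clm_apply hfib).congr_of_eventuallyEq (by
    filter_upwards [hsrc] with s hs
    exact trivializationAt_snd_eq_fderiv_transition (c s) hs.1 hs.2))
  have hw : fderiv ℝ (extChartAt 𝓘(ℝ, E) q ∘ (extChartAt 𝓘(ℝ, E) (c t).proj).symm)
      (extChartAt 𝓘(ℝ, E) (c t).proj (c t).proj)
      (tangentCoordChange 𝓘(ℝ, E) q (c t).proj (c t).proj w) = w := by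
    rw [fderiv_transition, tangentCoordChange_comp (by simp [hq]),
      tangentCoordChange_self (by simpa using hq)]
  have h1 := metricInChart_add_christoffelFirst hq hG hGq rfl hP (fiberVelocity c t)
    (baseVelocity c t) (fiberCoord c t t) (tangentCoordChange 𝓘(ℝ, E) q (c t).proj (c t).proj w)
  have h0 := metricInChart_extChartAt_self (c t).proj (fiberVelocity c t)
    (tangentCoordChange 𝓘(ℝ, E) q (c t).proj (c t).proj w)
  have h2 := hD t ht (tangentCoordChange 𝓘(ℝ, E) q (c t).proj (c t).proj w)
  rw [trivializationAt_symm_eq_tangentCoordChange hq]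
  refine (h2.trans ((congrArg (· + _) h0.symm).trans h1)).trans ?_
  have hvv' : fderiv ℝ (extChartAt 𝓘(ℝ, E) q ∘ (extChartAt 𝓘(ℝ, E) (c t).proj).symm)
      (extChartAt 𝓘(ℝ, E) (c t).proj (c t).proj) (fiberCoord c t t) = v := hvv.symm.trans hv
  rw [hw, hvv', ← hz', hvd, Function.comp_apply]

end Metric

/-! ### The Sasaki distance controls the fibre coordinates -/

section Sasaki

attribute [local instance] bilinNormedAddCommGroup bilinNormedSpace

variable {E : Type*} [NormedAddCommGroup E] [InnerProductSpace ℝ E]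
  {N : Type*} [TopologicalSpace N] [ChartedSpace E N] [IsManifold 𝓘(ℝ, E) 2 N]
  [RiemannianBundle (fun x : N ↦ TangentSpace 𝓘(ℝ, E) x)]

theorem isContinuousRiemannianBundle_of_contMDiff {n : WithTop ℕ∞}
    [h : IsContMDiffRiemannianBundle 𝓘(ℝ, E) n E (fun x : N ↦ TangentSpace 𝓘(ℝ, E) x)] :
    IsContinuousRiemannianBundle E (fun x : N ↦ TangentSpace 𝓘(ℝ, E) x) := by
  obtain ⟨g, hg, hg'⟩ := h.exists_contMDiff
  exact ⟨g, hg.continuous, hg'⟩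

/-- Bounds for the metric, its inverse and its first derivatives near a point. -/
theorem exists_metric_bounds
    [IsContMDiffRiemannianBundle 𝓘(ℝ, E) 1 E (fun x : N ↦ TangentSpace 𝓘(ℝ, E) x)] (q : N) :
    ∃ K : ℝ, 1 ≤ K ∧ ∃ G : E → E →L[ℝ] E →L[ℝ] ℝ,
      (∀ y ∈ (extChartAt 𝓘(ℝ, E) q).target, ∀ u w, metricInChart q y u w = G y u w) ∧
      ∀ᶠ x in 𝓝 q, x ∈ (chartAt E q).source ∧
        (∀ u, ‖(trivializationAt E (fun z : N ↦ TangentSpace 𝓘(ℝ, E) z) q).continuousLinearMapAt ℝ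
          x u‖ ≤ K * ‖u‖) ∧
        (∀ w, ‖(trivializationAt E (fun z : N ↦ TangentSpace 𝓘(ℝ, E) z) q).symm x w‖ ≤
          K * ‖w‖) ∧
        ∃ G' : E →L[ℝ] E →L[ℝ] E →L[ℝ] ℝ, HasFDerivAt G G' (extChartAt 𝓘(ℝ, E) q x) ∧
          ∀ a b c, |G' a b c| ≤ K * ‖a‖ * ‖b‖ * ‖c‖ := by
  have := isContinuousRiemannianBundle_of_contMDiff (E := E) (N := N) (n := 1)
  obtain ⟨G, hG, hGq⟩ := exists_contDiffAt_metricInChart (E := E) q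
  obtain ⟨C₁, -, h₁⟩ :=
    eventually_norm_trivializationAt_lt E (fun x : N ↦ TangentSpace 𝓘(ℝ, E) x) q
  obtain ⟨C₂, -, h₂⟩ :=
    eventually_norm_symmL_trivializationAt_lt E (fun x : N ↦ TangentSpace 𝓘(ℝ, E) x) q
  have hdiff : ∀ᶠ y in 𝓝 (extChartAt 𝓘(ℝ, E) q q), DifferentiableAt ℝ G y := by
    filter_upwards [hG.eventually (by simp)] with y hy using hy.differentiableAt (by simp)
  have hcont : ContinuousAt (fderiv ℝ G) (extChartAt 𝓘(ℝ, E) q q) :=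
    (hG.fderiv_right (m := 0) (by simp)).continuousAt
  obtain ⟨C₃, h₃⟩ : ∃ C₃ : ℝ, ∀ᶠ y in 𝓝 (extChartAt 𝓘(ℝ, E) q q), ‖fderiv ℝ G y‖ < C₃ :=
    ⟨‖fderiv ℝ G (extChartAt 𝓘(ℝ, E) q q)‖ + 1,
      hcont.norm.eventually (gt_mem_nhds (lt_add_one _))⟩
  refine ⟨max 1 (max C₁ (max C₂ C₃)), le_max_left _ _, G, hGq, ?_⟩
  have hext := (continuousAt_extChartAt (I := 𝓘(ℝ, E)) q).eventually (hdiff.and h₃)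
  filter_upwards [chart_source_mem_nhds E q, h₁, h₂, hext] with x hx hx₁ hx₂ hx₃
  refine ⟨hx, fun u ↦ ?_, fun w ↦ ?_, fderiv ℝ G (extChartAt 𝓘(ℝ, E) q x),
    hx₃.1.hasFDerivAt, fun a b c ↦ ?_⟩
  · exact ContinuousLinearMap.le_of_opNorm_le _ (hx₁.le.trans (by simp)) u
  · rw [← Trivialization.symmL_apply (R := ℝ) _ (by simpa using hx)]
    exact ContinuousLinearMap.le_of_opNorm_le _ (hx₂.le.trans (by simp)) w
  · rw [← Real.norm_eq_abs]
    refine ContinuousLinearMap.le_of_opNorm_le _ (ContinuousLinearMap.le_of_opNorm_le _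
      (ContinuousLinearMap.le_of_opNorm_le _ (hx₃.2.le.trans (by simp)) a) b) c

/-- Testing the covariant derivative against `v'` itself puts the squared Riemannian norm of `v'` on
one side and terms linear in `‖v'‖` on the other, so one factor can be divided out. The factor `1 +
‖v‖` appears because the Christoffel term is linear in `v`. -/
theorem IsCovariantDerivative.norm_deriv_le {c : ℝ → TangentBundle 𝓘(ℝ, E) N}
    {D : ∀ t : ℝ, TangentSpace 𝓘(ℝ, E) (c t).proj} (hD : IsCovariantDerivative c D) {t : ℝ}
    (ht : t ∈ Ioo (0 : ℝ) 1) (hc : ContMDiffAt 𝓘(ℝ, ℝ) 𝓘(ℝ, E).tangent 1 c t) {q : N}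
    (hq : (c t).proj ∈ (chartAt E q).source) {K : ℝ} (hK : 1 ≤ K)
    (hK₁ : ∀ u, ‖(trivializationAt E (fun z : N ↦ TangentSpace 𝓘(ℝ, E) z)
      q).continuousLinearMapAt ℝ (c t).proj u‖ ≤ K * ‖u‖)
    (hK₂ : ∀ w, ‖(trivializationAt E (fun z : N ↦ TangentSpace 𝓘(ℝ, E) z) q).symm (c t).proj w‖ ≤
      K * ‖w‖)
    {G : E → E →L[ℝ] E →L[ℝ] ℝ} {G' : E →L[ℝ] E →L[ℝ] E →L[ℝ] ℝ}
    (hG : HasFDerivAt G G' (extChartAt 𝓘(ℝ, E) q (c t).proj))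
    (hGq : ∀ y ∈ (extChartAt 𝓘(ℝ, E) q).target, ∀ u w, metricInChart q y u w = G y u w)
    (hG' : ∀ a b c, |G' a b c| ≤ K * ‖a‖ * ‖b‖ * ‖c‖) {v' : E}
    (hv' : HasDerivAt
      (fun s ↦ (trivializationAt E (fun z : N ↦ TangentSpace 𝓘(ℝ, E) z) q (c s)).2) v' t) :
    ‖v'‖ ≤ 2 * K ^ 4 *
      (1 + ‖(trivializationAt E (fun z : N ↦ TangentSpace 𝓘(ℝ, E) z) q (c t)).2‖) *
      √(‖baseVelocity c t‖ ^ 2 + ‖D t‖ ^ 2) := by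
  set v := (trivializationAt E (fun z : N ↦ TangentSpace 𝓘(ℝ, E) z) q (c t)).2 with hv
  set ℓ := √(‖baseVelocity c t‖ ^ 2 + ‖D t‖ ^ 2) with hℓ
  have hℓ₁ : ‖baseVelocity c t‖ ≤ ℓ := Real.le_sqrt_of_sq_le (by nlinarith [sq_nonneg ‖D t‖])
  have hℓ₂ : ‖D t‖ ≤ ℓ :=
    Real.le_sqrt_of_sq_le (by nlinarith [sq_nonneg ‖baseVelocity c t‖])
  have hℓ₀ : 0 ≤ ℓ := Real.sqrt_nonneg _
  obtain ⟨hcb, -⟩ := contMDiffAt_totalSpace.1 hc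
  have hzK := hK₁ (baseVelocity c t)
  set z : E := (trivializationAt E (fun z : N ↦ TangentSpace 𝓘(ℝ, E) z)
    q).continuousLinearMapAt ℝ (c t).proj (baseVelocity c t) with hzdef
  have hz : HasDerivAt (fun s ↦ extChartAt 𝓘(ℝ, E) q (c s).proj) z t :=
    hasDerivAt_extChartAt_comp (γ := fun s ↦ (c s).proj)
      (hasMFDerivAt_smulRight (hcb.mdifferentiableAt one_ne_zero)) hq
  have hmain := hD.inner_eq_in_chart ht hc hq hG hGq hz hv.symm hv' v'
  set ζ := (trivializationAt E (fun z : N ↦ TangentSpace 𝓘(ℝ, E) z) q).symm (c t).proj v' with hζ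
  have hself : G (extChartAt 𝓘(ℝ, E) q (c t).proj) v' v' = ‖ζ‖ ^ 2 := by
    rw [← hGq _ ((extChartAt 𝓘(ℝ, E) q).map_source (by simpa using hq)),
      metricInChart_extChartAt hq, real_inner_self_eq_norm_sq]
  have hζK : ‖v'‖ ≤ K * ‖ζ‖ := by
    have := hK₁ ζ
    rwa [hζ, ← Trivialization.symmL_apply (R := ℝ) _ (by simpa using hq),
      Trivialization.continuousLinearMapAt_symmL _ (by simpa using hq),
      Trivialization.symmL_apply (R := ℝ) _ (by simpa using hq)] at this
  have hin : inner ℝ (D t) ζ ≤ ℓ * (K * ‖v'‖) :=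
    (real_inner_le_norm _ _).trans (mul_le_mul hℓ₂ (hK₂ v') (norm_nonneg _) hℓ₀)
  have hzℓ : ‖z‖ ≤ K * ℓ := hzK.trans (by gcongr)
  have hS : ∀ a b c : E, ‖a‖ * ‖b‖ * ‖c‖ = ‖z‖ * ‖v‖ * ‖v'‖ →
      |G' a b c| ≤ K * (K * ℓ) * ‖v‖ * ‖v'‖ := fun a b c h ↦
    (hG' a b c).trans (by
      rw [mul_assoc, mul_assoc, ← mul_assoc ‖a‖, h]
      calc K * (‖z‖ * ‖v‖ * ‖v'‖) = K * ‖z‖ * ‖v‖ * ‖v'‖ := by ring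
        _ ≤ K * (K * ℓ) * ‖v‖ * ‖v'‖ := by gcongr)
  have h₁ := neg_le_of_abs_le (hS z v v' rfl)
  have h₂ := neg_le_of_abs_le (hS v z v' (by ring))
  have h₃ := le_of_abs_le (hS v' z v (by ring))
  rw [hself] at hmain
  have hsq : ‖ζ‖ ^ 2 ≤ (ℓ * K + 3 / 2 * (K ^ 2 * ℓ * ‖v‖)) * ‖v'‖ := by
    nlinarith
  rcases (norm_nonneg v').eq_or_lt with h0 | h0
  · rw [← h0]; positivity
  have hle : ‖v'‖ * ‖v'‖ ≤ (K ^ 2 * (ℓ * K + 3 / 2 * (K ^ 2 * ℓ * ‖v‖))) * ‖v'‖ := by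
    calc ‖v'‖ * ‖v'‖ ≤ (K * ‖ζ‖) * (K * ‖ζ‖) := by gcongr
      _ = K ^ 2 * ‖ζ‖ ^ 2 := by ring
      _ ≤ K ^ 2 * ((ℓ * K + 3 / 2 * (K ^ 2 * ℓ * ‖v‖)) * ‖v'‖) := by gcongr
      _ = _ := by ring
  refine (le_of_mul_le_mul_right hle h0).trans ?_
  -- The bound obtained is `K³ℓ + (3/2) K⁴ℓ‖v‖`; `1 ≤ K` absorbs it into `2K⁴(1 + ‖v‖)ℓ`.
  have hK3 : K ^ 3 ≤ K ^ 4 := pow_le_pow_right₀ hK (by norm_num)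
  have e₁ : K ^ 3 * ℓ ≤ K ^ 4 * ℓ := by gcongr
  have e₂ : 0 ≤ K ^ 4 * ℓ * ‖v‖ := by positivity
  have e₃ : 0 ≤ K ^ 4 * ℓ := by positivity
  nlinarith

end Sasaki

section SasakiLocal

attribute [local instance] bilinNormedAddCommGroup bilinNormedSpace

variable {E : Type*} [NormedAddCommGroup E] [InnerProductSpace ℝ E]
  {N : Type*} [EMetricSpace N] [ChartedSpace E N] [IsManifold 𝓘(ℝ, E) 2 N]
  [RiemannianBundle (fun x : N ↦ TangentSpace 𝓘(ℝ, E) x)]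

/-- A curve in the tangent bundle moves its base point at most by its Sasaki length. -/
theorem edist_proj_le_lintegral [IsRiemannianManifold 𝓘(ℝ, E) N]
    {c : ℝ → TangentBundle 𝓘(ℝ, E) N} {D : ∀ t : ℝ, TangentSpace 𝓘(ℝ, E) (c t).proj}
    (hc : ContMDiffOn 𝓘(ℝ, ℝ) 𝓘(ℝ, E).tangent 1 c (Icc 0 1)) {s : ℝ} (hs : s ∈ Icc (0 : ℝ) 1) :
    edist (c 0).proj (c s).proj ≤
      ∫⁻ t in Ioo (0 : ℝ) 1, ENNReal.ofReal (√(‖baseVelocity c t‖ ^ 2 + ‖D t‖ ^ 2)) := by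
  have hb : ContMDiffOn 𝓘(ℝ, ℝ) 𝓘(ℝ, E) 1 (fun s ↦ (c s).proj) (Icc 0 1) := fun t ht ↦
    (contMDiffWithinAt_totalSpace.1 (hc t ht)).1
  rw [IsRiemannianManifold.out (I := 𝓘(ℝ, E))]
  refine (riemannianEDist_le_pathELength (γ := fun s ↦ (c s).proj)
    (hb.mono (Icc_subset_Icc_right hs.2)) rfl rfl hs.1).trans ?_
  rw [pathELength_eq_lintegral_mfderiv_Ioo]
  refine (lintegral_mono_set (Ioo_subset_Ioo_right hs.2)).trans ?_
  refine lintegral_mono fun t ↦ ?_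
  rw [← ofReal_norm]
  refine ENNReal.ofReal_le_ofReal (Real.le_sqrt_of_sq_le ?_)
  exact le_add_of_nonneg_right (sq_nonneg ‖D t‖)

/-- A maximum argument replaces Gronwall. If `m` is the maximum of `‖v‖`, integration gives `‖v s -
v 0‖ ≤ 2K⁴(1 + m)l`; the smallness of `l` makes this at most `(1 + m)/2`, hence `m ≤ 2‖v 0‖ + 1`,
which is put back into the estimate. -/
theorem norm_fiber_sub_le_of_isCovariantDerivative {c : ℝ → TangentBundle 𝓘(ℝ, E) N}
    {D : ∀ t : ℝ, TangentSpace 𝓘(ℝ, E) (c t).proj}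
    (hc : ContMDiffOn 𝓘(ℝ, ℝ) 𝓘(ℝ, E).tangent 1 c (Icc 0 1)) (hD : IsCovariantDerivative c D)
    {q : N} {K : ℝ} (hK : 1 ≤ K) {G : E → E →L[ℝ] E →L[ℝ] ℝ}
    (hGq : ∀ y ∈ (extChartAt 𝓘(ℝ, E) q).target, ∀ u w, metricInChart q y u w = G y u w)
    (hbd : ∀ t ∈ Icc (0 : ℝ) 1, (c t).proj ∈ (chartAt E q).source ∧
      (∀ u, ‖(trivializationAt E (fun z : N ↦ TangentSpace 𝓘(ℝ, E) z) q).continuousLinearMapAt ℝ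
        (c t).proj u‖ ≤ K * ‖u‖) ∧
      (∀ w, ‖(trivializationAt E (fun z : N ↦ TangentSpace 𝓘(ℝ, E) z) q).symm (c t).proj w‖ ≤
        K * ‖w‖) ∧
      ∃ G' : E →L[ℝ] E →L[ℝ] E →L[ℝ] ℝ, HasFDerivAt G G' (extChartAt 𝓘(ℝ, E) q (c t).proj) ∧
        ∀ a b c, |G' a b c| ≤ K * ‖a‖ * ‖b‖ * ‖c‖)
    {l : ℝ} (hl0 : 0 ≤ l) (hlK : 4 * K ^ 4 * l ≤ 1)
    (hl : ∫⁻ t in Ioo (0 : ℝ) 1, ENNReal.ofReal (√(‖baseVelocity c t‖ ^ 2 + ‖D t‖ ^ 2)) ≤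
      ENNReal.ofReal l) :
    ‖(trivializationAt E (fun z : N ↦ TangentSpace 𝓘(ℝ, E) z) q (c 1)).2 -
      (trivializationAt E (fun z : N ↦ TangentSpace 𝓘(ℝ, E) z) q (c 0)).2‖ ≤
      4 * K ^ 4 *
        (1 + ‖(trivializationAt E (fun z : N ↦ TangentSpace 𝓘(ℝ, E) z) q (c 0)).2‖) * l := by
  set v : ℝ → E := fun s ↦ (trivializationAt E (fun z : N ↦ TangentSpace 𝓘(ℝ, E) z) q (c s)).2
    with hv
  have hvs : ContDiffOn ℝ 1 v (Icc 0 1) := by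
    rw [← contMDiffOn_iff_contDiffOn]
    exact ((Trivialization.contMDiffOn_iff (IB := 𝓘(ℝ, E))
      (e := trivializationAt E (fun z : N ↦ TangentSpace 𝓘(ℝ, E) z) q)
      (fun t ht ↦ by simpa using (hbd t ht).1)).1 hc).2
  obtain ⟨s₀, hs₀, hmax⟩ := isCompact_Icc.exists_isMaxOn (nonempty_Icc.2 zero_le_one)
    hvs.continuousOn.norm
  have hvm : ∀ t ∈ Icc (0 : ℝ) 1, ‖v t‖ ≤ ‖v s₀‖ := fun t ht ↦ hmax ht
  set m := ‖v s₀‖ with hm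
  have hm0 : 0 ≤ m := norm_nonneg _
  have hder : ∀ t ∈ Ioo (0 : ℝ) 1, ‖deriv v t‖ ≤
      2 * K ^ 4 * (1 + m) * √(‖baseVelocity c t‖ ^ 2 + ‖D t‖ ^ 2) := by
    intro t ht
    have ht' := Ioo_subset_Icc_self ht
    have hnhds := Icc_mem_nhds ht.1 ht.2
    obtain ⟨h₁, h₂, h₃, G', hG', hGb⟩ := hbd t ht'
    refine (hD.norm_deriv_le ht (hc.contMDiffAt hnhds) h₁ hK h₂ h₃ hG' hGq hGb
      ((hvs.contDiffAt hnhds).differentiableAt (by simp)).hasDerivAt).trans ?_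
    gcongr
    exact hvm t ht'
  have hsub : ∀ s ∈ Icc (0 : ℝ) 1, ‖v s - v 0‖ ≤ 2 * K ^ 4 * (1 + m) * l := by
    intro s hs
    have h₁ := enorm_sub_le_lintegral_deriv_of_contDiffOn_Icc
      (hvs.mono (Icc_subset_Icc_right hs.2)) hs.1
    rw [← restrict_Ioo_eq_restrict_Icc] at h₁
    have h₂ : ∫⁻ t in Ioo 0 s, ‖deriv v t‖ₑ ≤
        ENNReal.ofReal (2 * K ^ 4 * (1 + m)) * ENNReal.ofReal l :=
      calc ∫⁻ t in Ioo 0 s, ‖deriv v t‖ₑ ≤ ∫⁻ t in Ioo (0 : ℝ) 1, ‖deriv v t‖ₑ :=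
            lintegral_mono_set (Ioo_subset_Ioo_right hs.2)
        _ ≤ ∫⁻ t in Ioo (0 : ℝ) 1, ENNReal.ofReal (2 * K ^ 4 * (1 + m)) *
              ENNReal.ofReal (√(‖baseVelocity c t‖ ^ 2 + ‖D t‖ ^ 2)) := by
            refine setLIntegral_mono' measurableSet_Ioo fun t ht ↦ ?_
            rw [← ofReal_norm, ← ENNReal.ofReal_mul (by positivity)]
            exact ENNReal.ofReal_le_ofReal (hder t ht)
        _ ≤ _ := by
            rw [lintegral_const_mul' _ _ ENNReal.ofReal_ne_top]
            gcongr
    have h₃ := h₁.trans h₂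
    rw [← ofReal_norm, ← ENNReal.ofReal_mul (by positivity)] at h₃
    exact (ENNReal.ofReal_le_ofReal_iff (by positivity)).1 h₃
  have hm1 : m ≤ 2 * ‖v 0‖ + 1 := by
    have h₁ := hsub s₀ hs₀
    have h₂ := norm_le_norm_add_norm_sub' (v s₀) (v 0)
    nlinarith
  refine (hsub 1 (by simp)).trans ?_
  have : 2 * K ^ 4 * (1 + m) ≤ 4 * K ^ 4 * (1 + ‖v 0‖) := by
    have : 0 ≤ K ^ 4 := by positivity
    nlinarith
  gcongr

/-- Locally, and for vectors of bounded norm, the fibre coordinates are Lipschitz for the Sasaki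
distance. -/
theorem exists_edist_fiber_le_sasakiEDist
    [IsContMDiffRiemannianBundle 𝓘(ℝ, E) 1 E (fun x : N ↦ TangentSpace 𝓘(ℝ, E) x)]
    [IsRiemannianManifold 𝓘(ℝ, E) N] (q : N) (b : ℝ) :
    ∃ ρ > (0 : ℝ≥0∞), ∃ ε > (0 : ℝ≥0∞), ∃ C > (0 : ℝ≥0),
      ∀ ξ η : TangentBundle 𝓘(ℝ, E) N, edist ξ.proj q < ρ → ‖ξ.snd‖ ≤ b →
        sasakiEDist ξ η < ε →
        edist (trivializationAt E (fun z : N ↦ TangentSpace 𝓘(ℝ, E) z) q ξ).2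
          (trivializationAt E (fun z : N ↦ TangentSpace 𝓘(ℝ, E) z) q η).2 ≤
          C * sasakiEDist ξ η := by
  obtain ⟨K, hK, G, hGq, hev⟩ := exists_metric_bounds (E := E) q
  obtain ⟨R, hR, hball⟩ := EMetric.mem_nhds_iff.1 hev
  have hK0 : 0 < K := by linarith
  have hC : 0 < 4 * K ^ 4 * (1 + K * |b|) := by positivity
  -- A curve of length below `R / 2` starting within `R / 2` of `q` stays where the metric bounds
  -- hold; the other entry of `ε` is the smallness needed for the maximum argument. Only `ξ` has
  -- bounded norm, since `η` will be an arbitrary centre of a Sasaki ball.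
  refine ⟨R / 2, ENNReal.half_pos hR.ne', min (R / 2) (ENNReal.ofReal (1 / (4 * K ^ 4))),
    lt_min (ENNReal.half_pos hR.ne') (ENNReal.ofReal_pos.2 (by positivity)),
    Real.toNNReal (4 * K ^ 4 * (1 + K * |b|)), Real.toNNReal_pos.2 hC, fun ξ η hξ hξb hlt ↦ ?_⟩
  have hC0 : (Real.toNNReal (4 * K ^ 4 * (1 + K * |b|)) : ℝ≥0∞) ≠ 0 :=
    (ENNReal.ofReal_pos.2 hC).ne'
  rw [mul_comm, ← ENNReal.div_le_iff hC0 ENNReal.coe_ne_top]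
  refine le_of_forall_gt_imp_ge_of_dense fun r hr ↦ ?_
  wlog hrε : r < min (R / 2) (ENNReal.ofReal (1 / (4 * K ^ 4))) generalizing r
  · obtain ⟨s, hs, hsε⟩ := exists_between hlt
    exact (this s hs hsε).trans (hsε.le.trans (not_lt.1 hrε))
  rw [ENNReal.div_le_iff hC0 ENNReal.coe_ne_top, mul_comm]
  simp only [sasakiEDist, iInf_lt_iff] at hr
  obtain ⟨c, D, ⟨hc, rfl, rfl, hD⟩, hlen⟩ := hr
  have hrR := hrε.trans_le (min_le_left _ _)
  have hrK := hrε.trans_le (min_le_right _ _)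
  lift r to ℝ≥0 using hrK.ne_top
  have hbd := fun t (ht : t ∈ Icc (0 : ℝ) 1) ↦ hball (a := (c t).proj) (by
    rw [Metric.mem_eball]
    refine (edist_triangle_left _ _ (c 0).proj).trans_lt ?_
    calc edist (c 0).proj (c t).proj + edist (c 0).proj q < R / 2 + R / 2 :=
          ENNReal.add_lt_add (((edist_proj_le_lintegral (D := D) hc ht).trans_lt hlen).trans hrR) hξ
      _ = R := ENNReal.add_halves R)
  have hmain := norm_fiber_sub_le_of_isCovariantDerivative hc hD hK hGq hbd (l := r) r.coe_nonneg
    (by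
      rw [← ENNReal.ofReal_coe_nnreal, ENNReal.ofReal_lt_ofReal_iff (by positivity),
        lt_div_iff₀ (by positivity)] at hrK
      linarith)
    (by rw [ENNReal.ofReal_coe_nnreal]; exact hlen.le)
  have hv0 : ‖(trivializationAt E (fun z : N ↦ TangentSpace 𝓘(ℝ, E) z) q (c 0)).2‖ ≤ K * |b| := by
    have h := (hbd 0 (by simp)).2.1 (c 0).snd
    rw [Trivialization.continuousLinearMapAt_apply, Trivialization.coe_linearMapAt_of_mem _
      (by simpa using (hbd 0 (by simp)).1)] at h
    exact h.trans (by gcongr; exact hξb.trans (le_abs_self b))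
  rw [edist_comm, edist_dist, dist_eq_norm]
  refine (ENNReal.ofReal_le_ofReal (hmain.trans (mul_le_mul_of_nonneg_right
    (mul_le_mul_of_nonneg_left (add_le_add_right hv0 1) (by positivity)) r.coe_nonneg))).trans_eq ?_
  rw [ENNReal.ofReal_mul hC.le, ENNReal.ofReal_coe_nnreal]
  rfl

end SasakiLocal

/-! ### Propagation of total boundedness along curves -/

section LocalStep

variable {E : Type*} [NormedAddCommGroup E] [InnerProductSpace ℝ E]
  {N : Type*} [EMetricSpace N] [ChartedSpace E N] [IsManifold 𝓘(ℝ, E) 2 N]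
  [RiemannianBundle (fun x : N ↦ TangentSpace 𝓘(ℝ, E) x)]

/-- Consider curves `t ↦ f (x a t)` in `N` with velocity `V (x a t)`, where `V` is bounded by `b`
and satisfies near `q` a Lipschitz estimate for the measures of non-compactness. If their initial
points are in a compact set and close to `q`, then for a short time, which depends only on the
constants, they stay in a totally bounded set. -/
theorem exists_totallyBounded_of_hausdorffMNC_le
    [IsContMDiffRiemannianBundle 𝓘(ℝ, E) 1 E (fun x : N ↦ TangentSpace 𝓘(ℝ, E) x)]
    [IsRiemannianManifold 𝓘(ℝ, E) N] {M : Type*} {f : M → N}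
    {V : ∀ p, TangentSpace 𝓘(ℝ, E) (f p)} {U : Set M} {b : ℝ} (hb : 0 < b)
    (hV : ∀ p ∈ U, ‖V p‖ ≤ b) {q : N} {δ : ℝ} (hδ : 0 < δ) {c : ℝ≥0}
    (hlip : ∀ A ⊆ U ∩ f ⁻¹' Metric.eball q (ENNReal.ofReal δ),
      hausdorffMNC sasakiEDist ((fun p ↦ (⟨f p, V p⟩ : TangentBundle 𝓘(ℝ, E) N)) '' A) ≤
        c * hausdorffMNC edist (f '' A)) :
    ∃ ρ > (0 : ℝ≥0∞), ∃ σ > (0 : ℝ), ∀ {α : Type*} (x : α → ℝ → M) (S : Set α) (K₀ : Set N)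
      (s : ℝ), 0 < s → s ≤ σ → IsCompact K₀ → (∀ a ∈ S, f (x a 0) ∈ K₀ ∩ Metric.eball q ρ) →
      (∀ a ∈ S, ∀ t ∈ Icc 0 s, x a t ∈ U ∧
        edist (f (x a 0)) (f (x a t)) ≤ ENNReal.ofReal (b * t) ∧
        HasMFDerivAt 𝓘(ℝ, ℝ) 𝓘(ℝ, E) (fun t ↦ f (x a t)) t
          ((1 : ℝ →L[ℝ] ℝ).smulRight (V (x a t)))) →
      TotallyBounded (f '' image2 x S (Icc 0 s)) := by
  have := isContinuousRiemannianBundle_of_contMDiff (E := E) (N := N) (n := 1)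
  obtain ⟨ρ₁, hρ₁, ε, hε, C₁, hC₁, hsas⟩ := exists_edist_fiber_le_sasakiEDist (E := E) q b
  obtain ⟨C₂, hC₂, W, hW, hdist⟩ := exists_nhds_riemannianEDist_le_edist_extChartAt (E := E) q
  obtain ⟨ρ₂, hρ₂, hball⟩ := EMetric.mem_nhds_iff.1 (inter_mem hW (chart_source_mem_nhds E q))
  -- A radius below `n` brings the Sasaki measure of non-compactness, at most `c` times the radius,
  -- under the scale `ε` of the Lipschitz estimate.
  obtain ⟨n, hn, hnε⟩ := ENNReal.exists_nnreal_pos_mul_lt (a := (c : ℝ≥0∞)) ENNReal.coe_ne_top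
    hε.ne'
  obtain ⟨ρ₀, hρ₀, hρ₀m⟩ := ENNReal.lt_iff_exists_nnreal_btwn.1
    (show (0 : ℝ≥0∞) < min (min ρ₁ ρ₂) (min (ENNReal.ofReal δ) n) from
      lt_min (lt_min hρ₁ hρ₂) (lt_min (ENNReal.ofReal_pos.2 hδ) (ENNReal.coe_pos.2 hn)))
  simp only [lt_min_iff] at hρ₀m
  obtain ⟨⟨hρ₀1, hρ₀2⟩, hρ₀δ, hρ₀n⟩ := hρ₀m
  have hρ₀' : 0 < ρ₀ := ENNReal.coe_pos.1 hρ₀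
  -- The first bound on the time keeps the curves in the ball of radius `ρ₀`; the second makes the
  -- factor `2 * C₂ * C₁ * c * s` in the final inequality less than `1 / 2`.
  refine ⟨ρ₀ / 2, ENNReal.half_pos hρ₀.ne', min (ρ₀ / (2 * b)) (1 / (4 * C₂ * C₁ * c + 1)),
    lt_min (by positivity) (by positivity), ?_⟩
  intro α x S K₀ s hs hsσ hK₀ hstart hx
  have hs₁ : b * s ≤ ρ₀ / 2 := by
    have h := hsσ.trans (min_le_left _ _)
    rw [le_div_iff₀ (by positivity)] at h
    linarith
  have hs₂ : 4 * C₂ * C₁ * c * s < 1 := by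
    have h := hsσ.trans (min_le_right _ _)
    rw [le_div_iff₀ (by positivity)] at h
    nlinarith
  have hin : ∀ a ∈ S, ∀ t ∈ Icc 0 s, edist (f (x a t)) q < ρ₀ := by
    intro a ha t ht
    refine (edist_triangle_left _ _ (f (x a 0))).trans_lt ?_
    rw [← ENNReal.add_halves (ρ₀ : ℝ≥0∞)]
    refine ENNReal.add_lt_add_of_le_of_lt
      (ne_top_of_le_ne_top ENNReal.ofReal_ne_top (hx a ha t ht).2.1)
      ((hx a ha t ht).2.1.trans ?_) (hstart a ha).2
    have h : b * t ≤ ρ₀ / 2 := (mul_le_mul_of_nonneg_left ht.2 hb.le).trans hs₁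
    refine (ENNReal.ofReal_le_ofReal h).trans_eq ?_
    rw [ENNReal.ofReal_div_of_pos (by norm_num)]
    simp
  set A := image2 x S (Icc 0 s) with hA
  have hAball : ∀ p ∈ A, p ∈ U ∧ edist (f p) q < ρ₀ := by
    rintro _ ⟨a, ha, t, ht, rfl⟩
    exact ⟨(hx a ha t ht).1, hin a ha t ht⟩
  have hsub : f '' A ⊆ Metric.eball q ρ₀ := by
    rintro _ ⟨p, hp, rfl⟩
    exact (hAball p hp).2
  have hmnc : hausdorffMNC edist (f '' A) ≤ ρ₀ := hausdorffMNC_le_of_subset_eball hρ₀ hsub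
  have hfib := hlip A fun p hp ↦ ⟨(hAball p hp).1, (hAball p hp).2.trans hρ₀δ⟩
  set e := trivializationAt E (fun z : N ↦ TangentSpace 𝓘(ℝ, E) z) q with he
  have hsasA := hausdorffMNC_image_le_mul_of_lt (d' := edist) (f := fun ξ ↦ (e ξ).2) hC₁ (ε := ε)
    (S := (fun p ↦ (⟨f p, V p⟩ : TangentBundle 𝓘(ℝ, E) N)) '' A) (d := sasakiEDist) (by
      rintro _ ⟨p, hp, rfl⟩ η hη
      exact hsas _ η ((hAball p hp).2.trans hρ₀1) (hV p (hAball p hp).1) hη)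
    (hfib.trans_lt ((mul_le_mul_right (hmnc.trans hρ₀n.le) _).trans_lt (by rwa [mul_comm])))
  have hsrc : ∀ p ∈ A, f p ∈ W ∧ f p ∈ (chartAt E q).source := fun p hp ↦
    hball ((hAball p hp).2.trans hρ₀2)
  have hchart := hausdorffMNC_image_le_mul (f := f) (g := fun p ↦ extChartAt 𝓘(ℝ, E) q (f p))
    (S := A) hC₂ fun p hp p' hp' ↦ by
      rw [IsRiemannianManifold.out (I := 𝓘(ℝ, E))]
      exact hdist _ (hsrc p hp).1 _ (hsrc p' hp').1
  -- The chart is continuous only on its source, so `K₀` is cut down by a closed ball, which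
  -- preserves compactness.
  have hK : IsCompact (extChartAt 𝓘(ℝ, E) q '' (K₀ ∩ Metric.closedEBall q (ρ₀ / 2))) := by
    refine (hK₀.inter_right Metric.isClosed_closedEBall).image_of_continuousOn ?_
    refine (continuousOn_extChartAt q).mono fun y hy ↦ ?_
    rw [extChartAt_source]
    refine (hball ?_).2
    exact (Metric.mem_closedEBall.1 hy.2).trans_lt
      ((ENNReal.half_lt_self hρ₀.ne' ENNReal.coe_ne_top).trans hρ₀2)
  have hmv := hausdorffMNC_image2_le_of_hasDerivAt
    (x := fun a t ↦ extChartAt 𝓘(ℝ, E) q (f (x a t)))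
    (x' := fun a t ↦ (e ⟨f (x a t), V (x a t)⟩).2) (S := S) hs (fun a ha t ht ↦ by
      have hmem := (hsrc _ (mem_image2_of_mem ha ht)).2
      have h := hasDerivAt_extChartAt_comp (hx a ha t ht).2.2 hmem
      rwa [Trivialization.continuousLinearMapAt_apply, Trivialization.coe_linearMapAt_of_mem _
        (by simpa using hmem)] at h) hK
    (fun a ha ↦ mem_image_of_mem _ ⟨(hstart a ha).1, Metric.eball_subset_closedEBall
      (hstart a ha).2⟩)
  have e₁ : image2 (fun a t ↦ extChartAt 𝓘(ℝ, E) q (f (x a t))) S (Icc 0 s) =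
      (fun p ↦ extChartAt 𝓘(ℝ, E) q (f p)) '' A := by
    rw [hA, image_image2]
  have e₂ : image2 (fun a t ↦ (e ⟨f (x a t), V (x a t)⟩).2) S (Icc 0 s) =
      (fun ξ ↦ (e ξ).2) '' ((fun p ↦ (⟨f p, V p⟩ : TangentBundle 𝓘(ℝ, E) N)) '' A) := by
    rw [image_image, hA, image_image2]
  rw [e₁, e₂] at hmv
  refine totallyBounded_of_hausdorffMNC_eq_zero ?_
  set μ := hausdorffMNC edist (f '' A) with hμ
  -- The self-improving inequality: inverse chart, mean value inequality, Sasaki estimate, (C3)(ii).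
  -- Finiteness of `μ` then allows it to be absorbed.
  have hfinal : μ ≤ 2 * C₂ * (ENNReal.ofReal s * (C₁ * (c * μ))) := by
    refine hchart.trans ?_
    gcongr
    refine hmv.trans ?_
    gcongr
    exact hsasA.trans (by gcongr)
  have hμtop : μ ≠ ⊤ := ne_top_of_le_ne_top ENNReal.coe_ne_top hmnc
  have hreal := ENNReal.toReal_mono (by finiteness) hfinal
  simp only [ENNReal.toReal_mul, ENNReal.toReal_ofReal hs.le, ENNReal.coe_toReal,
    ENNReal.toReal_ofNat] at hreal
  refine ((ENNReal.toReal_eq_zero_iff μ).1 ?_).resolve_right hμtop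
  nlinarith [ENNReal.toReal_nonneg (a := μ)]

end LocalStep

/-! ### Images of integral curves -/

section IntegralCurve

variable {H : Type*} [NormedAddCommGroup H] [NormedSpace ℝ H]
  {M : Type*} [TopologicalSpace M] [ChartedSpace H M]
  {F : ∀ p : M, TangentSpace 𝓘(ℝ, H) p}

/-- An integral curve of a continuous vector field is of class `C¹`. -/
theorem contMDiff_of_isMIntegralCurve [IsManifold 𝓘(ℝ, H) 1 M]
    (hF : Continuous fun p ↦ (⟨p, F p⟩ : TangentBundle 𝓘(ℝ, H) M)) {γ : ℝ → M}
    (hγ : IsMIntegralCurve γ F) : ContMDiff 𝓘(ℝ, ℝ) 𝓘(ℝ, H) 1 γ := by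
  intro t₀
  rw [contMDiffAt_iff_target]
  refine ⟨hγ.continuous.continuousAt, ?_⟩
  rw [contMDiffAt_iff_contDiffAt, contDiffAt_one_iff]
  set e := trivializationAt H (fun z : M ↦ TangentSpace 𝓘(ℝ, H) z) (γ t₀) with he
  have hopen : IsOpen (γ ⁻¹' (chartAt H (γ t₀)).source) :=
    (chartAt H (γ t₀)).open_source.preimage hγ.continuous
  refine ⟨fun t ↦ (1 : ℝ →L[ℝ] ℝ).smulRight (e ⟨γ t, F (γ t)⟩).2, _,
    hopen.mem_nhds (mem_chart_source H (γ t₀)), ?_, fun t ht ↦ ?_⟩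
  · have h : ContinuousOn (fun t ↦ (e ⟨γ t, F (γ t)⟩).2)
        (γ ⁻¹' (chartAt H (γ t₀)).source) := by
      refine continuous_snd.comp_continuousOn (e.continuousOn.comp
        (hF.comp hγ.continuous).continuousOn fun t ht ↦ ?_)
      rw [e.mem_source]
      simpa [he] using ht
    exact (ContinuousLinearMap.smulRightL ℝ ℝ H 1).continuous.comp_continuousOn h
  · have h := hasDerivAt_extChartAt_comp (hγ t) ht
    rw [Trivialization.continuousLinearMapAt_apply, Trivialization.coe_linearMapAt_of_mem _
      (by simpa using ht)] at h
    exact h.hasFDerivAt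

variable {E : Type*} [NormedAddCommGroup E] [NormedSpace ℝ E]
  {N : Type*} [TopologicalSpace N] [ChartedSpace E N]
  {f : M → N} {U : Set M}

theorem hasMFDerivAt_comp_of_isMIntegralCurve (hU : IsOpen U)
    (hf : ContMDiffOn 𝓘(ℝ, H) 𝓘(ℝ, E) 1 f U) {γ : ℝ → M} (hγ : IsMIntegralCurve γ F) {t : ℝ}
    (ht : γ t ∈ U) :
    HasMFDerivAt 𝓘(ℝ, ℝ) 𝓘(ℝ, E) (fun t ↦ f (γ t)) t
      ((1 : ℝ →L[ℝ] ℝ).smulRight (mfderiv 𝓘(ℝ, H) 𝓘(ℝ, E) f (γ t) (F (γ t)))) := by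
  have h := ((hf.contMDiffAt (hU.mem_nhds ht)).mdifferentiableAt one_ne_zero).hasMFDerivAt.comp t
    (hγ t)
  refine h.congr_mfderiv (ContinuousLinearMap.ext fun (r : ℝ) ↦ ?_)
  exact (mfderiv 𝓘(ℝ, H) 𝓘(ℝ, E) f (γ t)).map_smul r (F (γ t))

end IntegralCurve

/-! ### Speed of the images of integral curves. -/

section Speed

variable {H : Type*} [NormedAddCommGroup H] [NormedSpace ℝ H]
  {M : Type*} [TopologicalSpace M] [ChartedSpace H M] [IsManifold 𝓘(ℝ, H) 1 M]
  {F : ∀ p : M, TangentSpace 𝓘(ℝ, H) p}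
  {E : Type*} [NormedAddCommGroup E] [NormedSpace ℝ E]
  {N : Type*} [EMetricSpace N] [ChartedSpace E N]
  [RiemannianBundle (fun x : N ↦ TangentSpace 𝓘(ℝ, E) x)] [IsRiemannianManifold 𝓘(ℝ, E) N]
  {f : M → N} {U : Set M}

theorem edist_le_of_isMIntegralCurve
    (hF : Continuous fun p ↦ (⟨p, F p⟩ : TangentBundle 𝓘(ℝ, H) M)) (hU : IsOpen U)
    (hf : ContMDiffOn 𝓘(ℝ, H) 𝓘(ℝ, E) 1 f U) {b : ℝ} (hb : 0 ≤ b)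
    (hV : ∀ p ∈ U, ‖mfderiv 𝓘(ℝ, H) 𝓘(ℝ, E) f p (F p)‖ ≤ b) {γ : ℝ → M}
    (hγ : IsMIntegralCurve γ F) {s t : ℝ} (hst : s ≤ t) (hγU : ∀ u ∈ Icc s t, γ u ∈ U) :
    edist (f (γ s)) (f (γ t)) ≤ ENNReal.ofReal (b * (t - s)) := by
  rw [IsRiemannianManifold.out (I := 𝓘(ℝ, E))]
  refine riemannianEDist_le_of_norm_mfderiv_le (γ := fun u ↦ f (γ u)) hst hb
    (hf.comp (contMDiff_of_isMIntegralCurve hF hγ).contMDiffOn hγU) fun u hu ↦ ?_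
  rw [(hasMFDerivAt_comp_of_isMIntegralCurve hU hf hγ (hγU u (Ioo_subset_Icc_self hu))).mfderiv]
  refine (congrArg norm ?_).trans_le (hV (γ u) (hγU u (Ioo_subset_Icc_self hu)))
  exact one_smul ℝ (mfderiv 𝓘(ℝ, H) 𝓘(ℝ, E) f (γ u) (F (γ u)))

end Speed

theorem totallyBounded_of_forall_edist_lt {X : Type*} [PseudoEMetricSpace X] {s : Set X}
    (h : ∀ ε > (0 : ℝ≥0∞), ∃ T, TotallyBounded T ∧ ∀ y ∈ s, ∃ z ∈ T, edist y z < ε) :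
    TotallyBounded s := by
  rw [EMetric.totallyBounded_iff]
  intro ε hε
  obtain ⟨T, hT, hs⟩ := h (ε / 2) (ENNReal.half_pos hε.ne')
  obtain ⟨C, hC, hTC⟩ := EMetric.totallyBounded_iff.1 hT (ε / 2) (ENNReal.half_pos hε.ne')
  refine ⟨C, hC, fun y hy ↦ ?_⟩
  obtain ⟨z, hz, hyz⟩ := hs y hy
  obtain ⟨c, hc, hzc⟩ := mem_iUnion₂.1 (hTC hz)
  refine mem_iUnion₂.2 ⟨c, hc, (edist_triangle y z c).trans_lt ?_⟩
  rw [← ENNReal.add_halves ε]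
  exact ENNReal.add_lt_add hyz hzc

/-! ### Total boundedness for as long as the curves stay in the domain. -/

section LongTime

variable {H : Type*} [NormedAddCommGroup H] [NormedSpace ℝ H]
  {M : Type*} [TopologicalSpace M] [ChartedSpace H M] [IsManifold 𝓘(ℝ, H) 1 M]
  {F : ∀ p : M, TangentSpace 𝓘(ℝ, H) p}
  {E : Type*} [NormedAddCommGroup E] [InnerProductSpace ℝ E]
  {N : Type*} [EMetricSpace N] [ChartedSpace E N] [IsManifold 𝓘(ℝ, E) 2 N]
  [RiemannianBundle (fun x : N ↦ TangentSpace 𝓘(ℝ, E) x)]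

/-- The images under `f` of the integral curves of `F` which start in a set with totally bounded
image remain in a totally bounded set as long as they are in the domain of `f`, if the velocity is
bounded and satisfies a Lipschitz estimate for the measures of non-compactness. -/
theorem totallyBounded_image2_of_isMIntegralCurve
    [IsContMDiffRiemannianBundle 𝓘(ℝ, E) 1 E (fun x : N ↦ TangentSpace 𝓘(ℝ, E) x)]
    [IsRiemannianManifold 𝓘(ℝ, E) N] [CompleteSpace N]
    (hF : Continuous fun p ↦ (⟨p, F p⟩ : TangentBundle 𝓘(ℝ, H) M)) {U : Set M} (hU : IsOpen U)
    {f : M → N} (hf : ContMDiffOn 𝓘(ℝ, H) 𝓘(ℝ, E) 1 f U) {b : ℝ} (hb : 0 < b)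
    (hV : ∀ p ∈ U, ‖mfderiv 𝓘(ℝ, H) 𝓘(ℝ, E) f p (F p)‖ ≤ b)
    (hlip : ∀ q : N, ∃ δ : ℝ, 0 < δ ∧ ∃ c : ℝ≥0,
      ∀ A ⊆ U ∩ f ⁻¹' Metric.eball q (ENNReal.ofReal δ),
        hausdorffMNC sasakiEDist ((fun p ↦ (⟨f p, mfderiv 𝓘(ℝ, H) 𝓘(ℝ, E) f p (F p)⟩ :
          TangentBundle 𝓘(ℝ, E) N)) '' A) ≤ c * hausdorffMNC edist (f '' A))
    {α : Type*} {x : α → ℝ → M} {S : Set α} {τ : ℝ} (hτ : 0 ≤ τ)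
    (hx : ∀ a ∈ S, IsMIntegralCurve (x a) F) (hxU : ∀ a ∈ S, ∀ t ∈ Icc 0 τ, x a t ∈ U)
    (h₀ : TotallyBounded ((fun a ↦ f (x a 0)) '' S)) :
    TotallyBounded (f '' image2 x S (Icc 0 τ)) := by
  have hspeed : ∀ a ∈ S, ∀ s t, 0 ≤ s → s ≤ t → t ≤ τ →
      edist (f (x a s)) (f (x a t)) ≤ ENNReal.ofReal (b * (t - s)) := fun a ha s t hs hst ht ↦
    edist_le_of_isMIntegralCurve hF hU hf hb.le hV (hx a ha) hst fun u hu ↦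
      hxU a ha u ⟨hs.trans hu.1, hu.2.trans ht⟩
  suffices h : Icc 0 τ ⊆ {t | TotallyBounded (f '' image2 x S (Icc 0 t))} from
    h (right_mem_Icc.2 hτ)
  refine IsClosed.Icc_subset_of_forall_mem_nhdsWithin ?_ ?_ ?_
  -- Closedness: by the speed bound, images up to time `t` are within `b * (t - t')` of those up to
  -- a good time `t'` close to `t`.
  · refine isClosed_of_closure_subset fun t ht ↦ ?_
    have htτ : t ∈ Icc 0 τ := closure_minimal inter_subset_right isClosed_Icc ht
    refine ⟨totallyBounded_of_forall_edist_lt fun ε hε ↦ ?_, htτ⟩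
    have hcont : Continuous fun t' ↦ ENNReal.ofReal (b * (t - t')) :=
      ENNReal.continuous_ofReal.comp (by fun_prop)
    have hev : ∀ᶠ t' in 𝓝 t, ENNReal.ofReal (b * (t - t')) < ε :=
      hcont.continuousAt.eventually_lt continuousAt_const (by simpa using hε)
    obtain ⟨t', ht', hbound⟩ := ((mem_closure_iff_frequently.1 ht).and_eventually hev).exists
    refine ⟨_, ht'.1, ?_⟩
    rintro _ ⟨_, ⟨a, ha, u, hu, rfl⟩, rfl⟩
    rcases le_total u t' with h | h
    · exact ⟨_, mem_image_of_mem f (mem_image2_of_mem ha ⟨hu.1, h⟩), by simpa using hε⟩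
    · refine ⟨_, mem_image_of_mem f (mem_image2_of_mem ha ⟨ht'.2.1, le_rfl⟩), ?_⟩
      rw [edist_comm]
      refine (hspeed a ha t' u ht'.2.1 h (hu.2.trans htτ.2)).trans_lt (lt_of_le_of_lt ?_ hbound)
      gcongr
      exact hu.2
  · change TotallyBounded _
    rwa [Icc_self, image2_singleton_right, image_image]
  · rintro t ⟨ht : TotallyBounded _, ht0, htτ⟩
    have hK : IsCompact (closure (f '' image2 x S (Icc 0 t))) :=
      isCompact_iff_totallyBounded_isComplete.2 ⟨ht.closure, isClosed_closure.isComplete⟩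
    have hstep : ∀ q : N, ∃ ρ > (0 : ℝ≥0∞), ∃ σ > (0 : ℝ), ∀ (y : α → ℝ → M) (S : Set α)
      (K₀ : Set N) (s : ℝ), 0 < s → s ≤ σ → IsCompact K₀ →
      (∀ a ∈ S, f (y a 0) ∈ K₀ ∩ Metric.eball q ρ) →
      (∀ a ∈ S, ∀ t ∈ Icc 0 s, y a t ∈ U ∧
        edist (f (y a 0)) (f (y a t)) ≤ ENNReal.ofReal (b * t) ∧
        HasMFDerivAt 𝓘(ℝ, ℝ) 𝓘(ℝ, E) (fun t ↦ f (y a t)) t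
          ((1 : ℝ →L[ℝ] ℝ).smulRight (mfderiv 𝓘(ℝ, H) 𝓘(ℝ, E) f (y a t) (F (y a t))))) →
      TotallyBounded (f '' image2 y S (Icc 0 s)) := by
      intro q
      obtain ⟨δ, hδ, c, hc⟩ := hlip q
      obtain ⟨ρ, hρ, σ, hσ, h⟩ := exists_totallyBounded_of_hausdorffMNC_le hb hV hδ hc
      exact ⟨ρ, hρ, σ, hσ, fun y S K₀ s ↦ h y S K₀ s⟩
    choose ρ hρ σ hσ hstep using hstep
    -- Finitely many balls contain all positions at time `t`, so finitely many steps `σ q` have a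
    -- common positive lower bound. Below, the curves are restarted at time `t` and grouped by the
    -- ball they are then in.
    obtain ⟨T, -, hT⟩ := hK.elim_nhds_subcover (fun q ↦ Metric.eball q (ρ q))
      fun q _ ↦ Metric.eball_mem_nhds q (hρ q)
    have hev : ∀ᶠ t' in 𝓝[>] t, ∀ q ∈ T, t' < t + σ q :=
      (eventually_all_finset T).2 fun q _ ↦ mem_of_superset
        (Ioo_mem_nhdsGT (lt_add_of_pos_right t (hσ q))) fun _ h ↦ h.2
    filter_upwards [hev, Ioo_mem_nhdsGT htτ] with t' ht' htt'
    refine (totallyBounded_union.2 ⟨ht, (totallyBounded_biUnion T.finite_toSet).2 fun q hq ↦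
      hstep q (fun a s ↦ x a (s + t)) {a ∈ S | f (x a t) ∈ Metric.eball q (ρ q)} _ (t' - t)
        (sub_pos.2 htt'.1) (by linarith [ht' q hq]) hK (fun a ha ↦ ?_)
        fun a ha s hs ↦ ⟨?_, ?_, ?_⟩⟩).subset ?_
    · rw [zero_add]
      exact ⟨subset_closure (mem_image_of_mem f (mem_image2_of_mem ha.1 ⟨ht0, le_rfl⟩)), ha.2⟩
    · exact hxU a ha.1 _ ⟨by linarith [hs.1], by linarith [hs.2, htt'.2]⟩
    · have := hspeed a ha.1 t (s + t) ht0 (by linarith [hs.1]) (by linarith [hs.2, htt'.2])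
      rwa [add_sub_cancel_right, ← zero_add t, ← add_assoc, add_zero] at this
    · exact hasMFDerivAt_comp_of_isMIntegralCurve hU hf ((hx a ha.1).comp_add t)
        (hxU a ha.1 _ ⟨by linarith [hs.1], by linarith [hs.2, htt'.2]⟩)
    · rintro _ ⟨_, ⟨a, ha, u, hu, rfl⟩, rfl⟩
      rcases le_total u t with h | h
      · exact Or.inl (mem_image_of_mem f (mem_image2_of_mem ha ⟨hu.1, h⟩))
      · obtain ⟨q, hq, hqa⟩ := mem_iUnion₂.1 (hT (subset_closure
          (mem_image_of_mem f (mem_image2_of_mem ha ⟨ht0, le_rfl⟩))))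
        refine Or.inr (mem_iUnion₂.2 ⟨q, hq, _, ⟨a, ⟨ha, hqa⟩, u - t, ⟨by linarith,
          by linarith [hu.2]⟩, rfl⟩, ?_⟩)
        simp

end LongTime

/-! ### The flow of a complete vector field -/

section FlowOfField

variable {H : Type*} [NormedAddCommGroup H] [NormedSpace ℝ H]
  {M : Type*} [TopologicalSpace M] [ChartedSpace H M] {F : ∀ p : M, TangentSpace 𝓘(ℝ, H) p}

theorem flow_zero (h : IsCompleteField F) (p : M) : flow h 0 p = p :=
  (h p).choose_spec.1

theorem isMIntegralCurve_flow (h : IsCompleteField F) (p : M) :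
    IsMIntegralCurve (fun t ↦ flow h t p) F :=
  (h p).choose_spec.2

variable [T2Space M] [IsManifold 𝓘(ℝ, H) 1 M]

/-- `flow` is built from arbitrary choices of integral curves; uniqueness for `C¹` fields on a
Hausdorff manifold makes these choices compatible. -/
theorem flow_add (h : IsCompleteField F)
    (hF : ContMDiff 𝓘(ℝ, H) 𝓘(ℝ, H).tangent 1 (fun p ↦ (⟨p, F p⟩ : TangentBundle 𝓘(ℝ, H) M)))
    (s t : ℝ) (p : M) : flow h (s + t) p = flow h s (flow h t p) :=
  congrFun (isMIntegralCurve_Ioo_eq_of_contMDiff_boundaryless (t₀ := 0) hF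
    ((isMIntegralCurve_flow h p).comp_add t) (isMIntegralCurve_flow h (flow h t p))
    (by simp [flow_zero])) s

end FlowOfField

/-- An integral curve starting at `p` does not leave `U` as long as its image under `f`, which
moves with speed at most `b`, is in a ball around `f p` whose preimage has closure in `U`. -/
theorem mem_of_closure_preimage_subset {H : Type*} [NormedAddCommGroup H] [NormedSpace ℝ H]
    {M : Type*} [TopologicalSpace M] [ChartedSpace H M] [IsManifold 𝓘(ℝ, H) 1 M]
    {F : ∀ p : M, TangentSpace 𝓘(ℝ, H) p}
    {E : Type*} [NormedAddCommGroup E] [NormedSpace ℝ E]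
    {N : Type*} [EMetricSpace N] [ChartedSpace E N]
    [RiemannianBundle (fun x : N ↦ TangentSpace 𝓘(ℝ, E) x)] [IsRiemannianManifold 𝓘(ℝ, E) N]
    (hF : Continuous fun p ↦ (⟨p, F p⟩ : TangentBundle 𝓘(ℝ, H) M)) {U : Set M} (hU : IsOpen U)
    {f : M → N} (hf : ContMDiffOn 𝓘(ℝ, H) 𝓘(ℝ, E) 1 f U) {b : ℝ} (hb : 0 < b)
    (hV : ∀ p ∈ U, ‖mfderiv 𝓘(ℝ, H) 𝓘(ℝ, E) f p (F p)‖ ≤ b) {γ : ℝ → M}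
    (hγ : IsMIntegralCurve γ F) (h₀ : γ 0 ∈ U) {r τ : ℝ} (hτ : b * τ < r)
    (hr : closure (U ∩ f ⁻¹' Metric.eball (f (γ 0)) (ENNReal.ofReal r)) ⊆ U) :
    ∀ t ∈ Icc 0 τ, γ t ∈ U := by
  suffices h : Icc 0 τ ⊆ {t | ∀ u ∈ Icc 0 t, γ u ∈ U} from
    fun t ht ↦ h ht t ⟨ht.1, le_rfl⟩
  refine IsClosed.Icc_subset_of_forall_mem_nhdsWithin ?_
    (fun u hu ↦ by rwa [le_antisymm hu.2 hu.1]) ?_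
  · refine isClosed_of_closure_subset fun t ht ↦ ?_
    have htτ : t ∈ Icc 0 τ := closure_minimal inter_subset_right isClosed_Icc ht
    refine ⟨fun u hu ↦ ?_, htτ⟩
    rcases hu.2.lt_or_eq with hut | rfl
    · obtain ⟨t', ht', hut'⟩ :=
        ((mem_closure_iff_frequently.1 ht).and_eventually (lt_mem_nhds hut)).exists
      exact ht'.1 u ⟨hu.1, hut'.le⟩
    -- The curve reaches `γ u` through points of `U` whose images lie in the ball, so `γ u` is in
    -- the closure that `hr` places inside `U`.
    · refine hr (map_mem_closure hγ.continuous ht fun t' ht' ↦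
        ⟨ht'.1 t' ⟨ht'.2.1, le_rfl⟩, ?_⟩)
      rw [mem_preimage, Metric.mem_eball, edist_comm]
      refine (edist_le_of_isMIntegralCurve hF hU hf hb.le hV hγ ht'.2.1 ht'.1).trans_lt ?_
      have h : b * t' < r := (mul_le_mul_of_nonneg_left ht'.2.2 hb.le).trans_lt hτ
      rw [sub_zero]
      exact (ENNReal.ofReal_lt_ofReal_iff
        ((mul_nonneg hb.le ht'.2.1).trans_lt h)).2 h
  · rintro t ⟨ht, ht0, -⟩
    obtain ⟨l, w, ⟨hl, hw⟩, hsub⟩ := mem_nhds_iff_exists_Ioo_subset.1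
      ((hU.preimage hγ.continuous).mem_nhds (ht t ⟨ht0, le_rfl⟩))
    filter_upwards [Ioo_mem_nhdsGT hw] with t' ht' u hu
    rcases le_total u t with h | h
    · exact ht u ⟨hu.1, h⟩
    · exact hsub ⟨hl.trans_le h, hu.2.trans_lt ht'.2⟩

/-! ### The family of sets with pre-compact images -/

section Family

variable {M I : Type*} {N : I → Type*} [∀ i, TopologicalSpace (N i)]
  {U : I → Set M} {Q : ∀ i, M → N i}

theorem verticalFamily_mono {A B : Set M} (hB : B ∈ verticalFamily U Q) (hAB : A ⊆ B) :
    A ∈ verticalFamily U Q := by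
  obtain ⟨⟨J, hJ, hBJ⟩, hBc⟩ := hB
  exact ⟨⟨J, hJ, hAB.trans hBJ⟩, fun i ↦ (hBc i).of_isClosed_subset isClosed_closure
    (closure_mono (image_mono (inter_subset_inter_left _ hAB)))⟩

theorem biUnion_mem_verticalFamily {ι : Type*} {T : Set ι} (hT : T.Finite) {B : ι → Set M}
    (hB : ∀ i ∈ T, B i ∈ verticalFamily U Q) : ⋃ i ∈ T, B i ∈ verticalFamily U Q := by
  constructor
  · choose! J hJ hBJ using fun i hi ↦ (hB i hi).1
    refine ⟨⋃ i ∈ T, J i, hT.biUnion hJ, iUnion₂_subset fun i hi ↦ (hBJ i hi).trans ?_⟩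
    exact biUnion_subset_biUnion_left (subset_biUnion_of_mem hi)
  · intro j
    rw [iUnion₂_inter, image_iUnion₂, hT.closure_biUnion]
    exact hT.isCompact_biUnion fun i hi ↦ (hB i hi).2 j

end Family

/-! ### Positive invariance -/

section Invariance

variable {H : Type*} [NormedAddCommGroup H] [InnerProductSpace ℝ H] [CompleteSpace H]
  {M : Type*} [TopologicalSpace M] [ChartedSpace H M] [IsManifold 𝓘(ℝ, H) 2 M]
  {E : Type*} [NormedAddCommGroup E] [InnerProductSpace ℝ E]
  {I : Type*} {N : I → Type*} [∀ i, EMetricSpace (N i)] [∀ i, ChartedSpace E (N i)]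
  [∀ i, IsManifold 𝓘(ℝ, E) 2 (N i)]
  {𝓔 : EssentialSubbundle H M} {U : I → Set M} {Q : ∀ i, M → N i}

/-- For a set inside one `U i`, pre-compactness under `Q i` suffices: applied to `B ∩ U j`,
`precompact_iff` transfers it to each other index. -/
theorem IsStrongPresentation.mem_verticalFamily (hpres : IsStrongPresentation (E := E) 𝓔 U Q)
    {i : I} {B : Set M} (hB : B ⊆ U i) (hc : IsCompact (closure (Q i '' B))) :
    B ∈ verticalFamily U Q := by
  refine ⟨⟨{i}, finite_singleton i, by simpa using hB⟩, fun j ↦ ?_⟩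
  refine (hpres.precompact_iff i j _ (inter_subset_inter_left _ hB)).1 ?_
  exact hc.of_isClosed_subset isClosed_closure (closure_mono (image_mono inter_subset_left))

variable [∀ i, RiemannianBundle (fun x : N i ↦ TangentSpace 𝓘(ℝ, E) x)]
  {F : ∀ p : M, TangentSpace 𝓘(ℝ, H) p}

/-- The flow preserves the family for a short time, which is the same for all its members. -/
theorem exists_image2_flow_mem_verticalFamily
    (hpres : IsAdmissiblePresentation (E := E) 𝓔 U Q)
    (hF : Continuous fun p ↦ (⟨p, F p⟩ : TangentBundle 𝓘(ℝ, H) M))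
    (hcomplete : IsCompleteField F) (hC3 : ConditionC3 (E := E) U Q F) :
    ∃ τ > 0, ∀ A ∈ verticalFamily U Q,
      image2 (flow hcomplete) (Icc 0 τ) A ∈ verticalFamily U Q := by
  obtain ⟨r, hr, hunif⟩ := hpres.uniform
  obtain ⟨b, hb, hV⟩ := hC3.bounded
  have hτ : b * (r / (2 * b)) < r := by
    field_simp
    linarith
  -- This time depends only on `r` and `b`; at speed `b` a curve covers at most `r / 2` in it.
  refine ⟨r / (2 * b), by positivity, fun A hA ↦ ?_⟩
  obtain ⟨J, hJ, hAJ⟩ := hA.1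
  set S : I → Set M := fun i ↦ {p ∈ A | p ∈ U i ∧
    closure (preimageOn U Q i (Metric.eball (Q i p) (ENNReal.ofReal r))) ⊆ U i} with hS
  -- Points of `A` are sorted by an index `i` good for the uniformity condition. Such a `U i` meets
  -- some `U j` with `j ∈ J`, so star-finiteness leaves finitely many `i`.
  refine verticalFamily_mono (biUnion_mem_verticalFamily
    (hJ.biUnion fun j _ ↦ hpres.star_finite j)
    (B := fun i ↦ image2 (flow hcomplete) (Icc 0 (r / (2 * b))) (S i)) fun i _ ↦ ?_) ?_
  · have := hpres.contMDiff_metric i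
    have := hpres.edist_eq i
    have := hpres.complete i
    have hstay : ∀ p ∈ S i, ∀ t ∈ Icc 0 (r / (2 * b)), flow hcomplete t p ∈ U i := by
      intro p hp
      refine mem_of_closure_preimage_subset hF (hpres.isOpen i) (hpres.contMDiffOn i) hb (hV i)
        (isMIntegralCurve_flow hcomplete p) ?_ hτ ?_
      · simpa only [flow_zero] using hp.2.1
      · simpa only [flow_zero, preimageOn] using hp.2.2
    refine hpres.toIsStrongPresentation.mem_verticalFamily (i := i) (image2_subset_iff.2
      fun t ht p hp ↦ hstay p hp t ht) ?_
    have htb : TotallyBounded (Q i '' image2 (fun p t ↦ flow hcomplete t p) (S i)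
        (Icc 0 (r / (2 * b)))) := by
      refine totallyBounded_image2_of_isMIntegralCurve hF (hpres.isOpen i) (hpres.contMDiffOn i)
        hb (hV i) (hC3.lipschitz i) (by positivity)
        (fun p _ ↦ isMIntegralCurve_flow hcomplete p) hstay ?_
      simp only [flow_zero]
      exact (hA.2 i).totallyBounded.subset ((image_mono
        (show S i ⊆ A ∩ U i from fun p hp ↦ ⟨hp.1, hp.2.1⟩)).trans subset_closure)
    rw [image2_swap]
    exact isCompact_iff_totallyBounded_isComplete.2 ⟨htb.closure, isClosed_closure.isComplete⟩
  · rintro _ ⟨t, ht, p, hp, rfl⟩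
    obtain ⟨j, hj, hpj⟩ := mem_iUnion₂.1 (hAJ hp)
    obtain ⟨i, hpi, hcl⟩ := hunif p
    exact mem_iUnion₂.2 ⟨i, mem_iUnion₂.2 ⟨j, hj, p, hpj, hpi⟩,
      mem_image2_of_mem ht ⟨hp, hpi, hcl⟩⟩

end Invariance

end EssentialFlow

end

/-! ### The theorem, by iterating the uniform short time. -/

open EssentialFlow in
theorem mainTheorem5
    {H : Type*} [NormedAddCommGroup H] [InnerProductSpace ℝ H] [CompleteSpace H]
    {M : Type*} [TopologicalSpace M] [T2Space M] [ParacompactSpace M]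
    [ChartedSpace H M] [IsManifold 𝓘(ℝ, H) 2 M]
    {E : Type*} [NormedAddCommGroup E] [InnerProductSpace ℝ E] [CompleteSpace E]
    {I : Type*} {N : I → Type*} [∀ i, EMetricSpace (N i)] [∀ i, ChartedSpace E (N i)]
    [∀ i, IsManifold 𝓘(ℝ, E) 2 (N i)]
    [∀ i, RiemannianBundle (fun x : N i ↦ TangentSpace 𝓘(ℝ, E) x)]
    (𝓔 : EssentialSubbundle H M) (U : I → Set M) (Q : ∀ i, M → N i)
    (hpres : IsAdmissiblePresentation (E := E) 𝓔 U Q)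
    (F : ∀ p : M, TangentSpace 𝓘(ℝ, H) p)
    (hF : ContMDiff 𝓘(ℝ, H) 𝓘(ℝ, H).tangent 1
      (fun p ↦ (⟨p, F p⟩ : TangentBundle 𝓘(ℝ, H) M)))
    (hcomplete : IsCompleteField F)
    (hC3 : ConditionC3 (E := E) U Q F) :
    IsPositivelyInvariant (flow hcomplete) (verticalFamily U Q) := by
  intro A hA t _
  obtain ⟨τ, hτ, hstep⟩ :=
    exists_image2_flow_mem_verticalFamily hpres hF.continuous hcomplete hC3
  have hiter : ∀ n : ℕ, image2 (flow hcomplete) (Icc 0 (n * τ)) A ∈ verticalFamily U Q := by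
    intro n
    induction n with
    | zero =>
      refine verticalFamily_mono hA (image2_subset_iff.2 fun s hs p hp ↦ ?_)
      rw [Nat.cast_zero, zero_mul, Icc_self] at hs
      rwa [hs, flow_zero]
    | succ n ih =>
      refine verticalFamily_mono (hstep _ ih) (image2_subset_iff.2 fun s hs p hp ↦ ?_)
      rw [Nat.cast_succ, add_one_mul] at hs
      rcases le_total s (n * τ) with h | h
      -- A point already reached by time `n * τ` is flowed for time 0; a later time is split as `(s
      -- - n * τ) + n * τ` by the group law.
      · rw [← flow_zero hcomplete (flow hcomplete s p)]
        exact mem_image2_of_mem ⟨le_rfl, hτ.le⟩ (mem_image2_of_mem ⟨hs.1, h⟩ hp)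
      · rw [← sub_add_cancel s (n * τ), flow_add hcomplete hF]
        exact mem_image2_of_mem ⟨sub_nonneg.2 h, by linarith [hs.2]⟩
          (mem_image2_of_mem ⟨by positivity, le_rfl⟩ hp)
  obtain ⟨n, hn⟩ := exists_nat_ge (t / τ)
  exact verticalFamily_mono (hiter n)
    (image2_subset_right (Icc_subset_Icc_right ((div_le_iff₀ hτ).1 hn)))
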